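/- Let $d\ge 1$, $N\ge 2$, $1<p<\infty$, $1<q\le\infty$ with conjugate exponent $q'$ ($\frac1q+\frac1{q'}=1$), let $\lambda_1,\dots,\lambda_N>0$ with $\sum_{i=1}^N\lambda_i=1$, and set $\alpha_p=\frac{p-2}{p-1}$. Let $\mu_i=\delta_{\hat x_i}$ with $\hat x_i\in\mathbb{R}^d$ for $i=2,\dots,N$, and let $\mu_1=f_1\,\mathrm{d}\mathcal{L}^d$ be a probability measure on $\mathbb{R}^d$ with density $0\le f_1\in L^q(\mathbb{R}^d)$. Assume that $\operatorname{spt}\mu_i\subset B_{M/2}(0)$ for every $i=1,\dots,N$. Put $$\mathrm{bar}_p(x_1)=\operatorname*{argmin}_{z\in\mathbb{R}^d}\Big(\lambda_1|x_1-z|^p+\sum_{i=2}^N\lambda_i|\hat x_i-z|^p\Big),\qquad \overline z_p=\operatorname*{argmin}_{z\in\mathbb{R}^d}\sum_{i=2}^N\lambda_i|\hat x_i-z|^p .$$ Assume that either 1. $p\ge2$ and $\overline z_p\notin\operatorname{spt}\mu_1$, and set $\delta=\operatorname{dist}\big(\mathrm{bar}_p(\operatorname{spt}\mu_1),\overline z_p\big)$;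 or 2. $1<p<2$ and $\mathrm{bar}_p(x_1)\ne\hat x_i$ for every $i=2,\dots,N$ and every $x_1\in\operatorname{spt}\mu_1$, and set $\delta=\min_{2\le i\le N}\operatorname{dist}\big(\mathrm{bar}_p(\operatorname{spt}\mu_1),\hat x_i\big)$. Then $\delta>0$; the $p$-Wasserstein barycenter $\nu_p$, i.e. the minimizer of $\nu\mapsto\sum_{i=1}^N\lambda_iW_p(\mu_i,\nu)^p$ over the probability measures on $\mathbb{R}^d$ with finite $p$-th moment, exists, is unique and is absolutely continuous, $\nu_p=g_p\,\mathrm{d}\mathcal{L}^d$; and $g_p\in L^q(\mathbb{R}^d)$ with $$\|g_p\|_{L^q}\le\frac{C}{\lambda_1^{\,d\,q'(1-\alpha_p)}}\,\|f_1\|_{L^q},$$ where $C\in(0,\infty)$ depends only on $M$, $p$, $d$ and $\delta$. -/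

import Mathlib

open MeasureTheory
open scoped ENNReal

/-- The objective `z ↦ ∑ᵢ λᵢ |xᵢ - z|ᵖ` of the Euclidean `p`-barycenter problem. -/
noncomputable def pCost {d : ℕ} {ι : Type} [Fintype ι] (p : ℝ) (lam : ι → ℝ)
    (x : ι → EuclideanSpace ℝ (Fin d)) (z : EuclideanSpace ℝ (Fin d)) : ℝ :=
  ∑ i, lam i * ‖x i - z‖ ^ p

/-- The Euclidean `p`-barycenter `argmin_z ∑ᵢ λᵢ |xᵢ - z|ᵖ` of the points `xᵢ` with weights `λᵢ`.
For `p > 1`, positive weights and at least one point the minimizer exists and is unique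
(`pBarycenter_isUniqueMin` below). -/
noncomputable def pBarycenter {d : ℕ} {ι : Type} [Fintype ι] (p : ℝ) (lam : ι → ℝ)
    (x : ι → EuclideanSpace ℝ (Fin d)) : EuclideanSpace ℝ (Fin d) :=
  Classical.epsilon fun z => ∀ w, pCost p lam x z ≤ pCost p lam x w

theorem exists_pCost_min {d : ℕ} {ι : Type} [Fintype ι] [Nonempty ι] {p : ℝ} (hp : 1 < p)
    {lam : ι → ℝ} (hlam : ∀ i, 0 < lam i) (x : ι → EuclideanSpace ℝ (Fin d)) :
    ∃ z, ∀ w, pCost p lam x z ≤ pCost p lam x w := by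
  have hp0 : 0 < p := by linarith
  have hcont : Continuous (pCost p lam x) := by
    unfold pCost
    refine continuous_finsetSum _ fun i _ => continuous_const.mul ?_
    exact (continuous_const.sub continuous_id).norm.rpow_const fun _ => Or.inr hp0.le
  refine hcont.exists_forall_le ?_
  obtain ⟨i⟩ := ‹Nonempty ι›
  have h1 : Filter.Tendsto (fun z : EuclideanSpace ℝ (Fin d) => ‖x i - z‖)
      (Filter.cocompact _) Filter.atTop := by
    have h2 := Filter.tendsto_atTop_add_const_right _ (-‖x i‖)
      (tendsto_norm_cocompact_atTop (E := EuclideanSpace ℝ (Fin d)))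
    refine Filter.tendsto_atTop_mono (fun z => ?_) h2
    have := norm_sub_norm_le z (x i)
    rw [norm_sub_rev] at this
    linarith
  have h3 := ((tendsto_rpow_atTop hp0).comp h1).const_mul_atTop (hlam i)
  refine Filter.tendsto_atTop_mono (fun z => ?_) h3
  exact Finset.single_le_sum (f := fun j => lam j * ‖x j - z‖ ^ p)
    (fun j _ => mul_nonneg (hlam j).le (Real.rpow_nonneg (norm_nonneg _) _)) (Finset.mem_univ i)

theorem norm_rpow_midpoint_lt {d : ℕ} {p : ℝ} (hp : 1 < p) {a b : EuclideanSpace ℝ (Fin d)}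
    (hab : a ≠ b) :
    ‖(1 / 2 : ℝ) • (a + b)‖ ^ p < (1 / 2 : ℝ) * ‖a‖ ^ p + (1 / 2 : ℝ) * ‖b‖ ^ p := by
  have hp0 : 0 < p := by linarith
  have htri : ‖(1 / 2 : ℝ) • (a + b)‖ ≤ (1 / 2 : ℝ) * ‖a‖ + (1 / 2 : ℝ) * ‖b‖ := by
    rw [norm_smul, ← mul_add]
    norm_num
    exact norm_add_le a b
  by_cases h : ‖a‖ = ‖b‖
  · have hlt := (norm_midpoint_lt_iff (x := a) (y := b) h).2 hab
    have := Real.rpow_lt_rpow (norm_nonneg _) hlt hp0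
    rw [← h]
    linarith
  · have h2 := (strictConvexOn_rpow hp).2 (norm_nonneg a : ‖a‖ ∈ Set.Ici 0)
      (norm_nonneg b : ‖b‖ ∈ Set.Ici 0) h (by norm_num : (0 : ℝ) < 1 / 2)
      (by norm_num : (0 : ℝ) < 1 / 2) (by norm_num)
    simp only [smul_eq_mul] at h2
    exact lt_of_le_of_lt (Real.rpow_le_rpow (norm_nonneg _) htri hp0.le) h2

/-- The Euclidean `p`-barycenter is the unique minimizer of its objective. -/
theorem pBarycenter_isUniqueMin {d : ℕ} {ι : Type} [Fintype ι] [Nonempty ι] {p : ℝ} (hp : 1 < p)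
    {lam : ι → ℝ} (hlam : ∀ i, 0 < lam i) (x : ι → EuclideanSpace ℝ (Fin d))
    (z : EuclideanSpace ℝ (Fin d)) :
    (∀ w, pCost p lam x z ≤ pCost p lam x w) ↔ z = pBarycenter p lam x := by
  have hmin : ∀ w, pCost p lam x (pBarycenter p lam x) ≤ pCost p lam x w :=
    Classical.epsilon_spec (exists_pCost_min hp hlam x)
  refine ⟨fun hz => ?_, fun h => h ▸ hmin⟩
  by_contra hne
  set y := pBarycenter p lam x with hy
  have hlt : pCost p lam x ((1 / 2 : ℝ) • (z + y)) <
      (1 / 2 : ℝ) * pCost p lam x z + (1 / 2 : ℝ) * pCost p lam x y := by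
    unfold pCost
    rw [Finset.mul_sum, Finset.mul_sum, ← Finset.sum_add_distrib]
    refine Finset.sum_lt_sum_of_nonempty Finset.univ_nonempty fun i _ => ?_
    have hi : x i - (1 / 2 : ℝ) • (z + y) = (1 / 2 : ℝ) • ((x i - z) + (x i - y)) := by
      module
    have hne' : x i - z ≠ x i - y := fun h => hne (sub_right_injective h)
    rw [hi]
    have := mul_lt_mul_of_pos_left (norm_rpow_midpoint_lt hp hne') (hlam i)
    linarith
  have h1 := hz y
  have h2 := hz ((1 / 2 : ℝ) • (z + y))
  have h3 := hmin z
  linarith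

/-- `π` is a transport plan (coupling) between `μ` and `ν`: its marginals are `μ` and `ν`. -/
def IsTransportPlan {d : ℕ} (μ ν : Measure (EuclideanSpace ℝ (Fin d)))
    (π : Measure (EuclideanSpace ℝ (Fin d) × EuclideanSpace ℝ (Fin d))) : Prop :=
  π.fst = μ ∧ π.snd = ν

/-- The `p`-Wasserstein distance
`W_p(μ, ν) = (inf { ∫ |x - y|ᵖ dπ(x, y) : π a transport plan between μ and ν })^{1/p}`. -/
noncomputable def wassersteinDist {d : ℕ} (p : ℝ)
    (μ ν : Measure (EuclideanSpace ℝ (Fin d))) : ℝ≥0∞ :=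
  (⨅ (π : Measure (EuclideanSpace ℝ (Fin d) × EuclideanSpace ℝ (Fin d)))
    (_ : IsTransportPlan μ ν π), ∫⁻ w, edist w.1 w.2 ^ p ∂π) ^ (1 / p)

/-- `ν ∈ 𝒫_p(ℝᵈ)`: a Borel probability measure with finite `p`-th moment. -/
def MemProbP {d : ℕ} (p : ℝ) (ν : Measure (EuclideanSpace ℝ (Fin d))) : Prop :=
  IsProbabilityMeasure ν ∧ ∫⁻ x, ‖x‖ₑ ^ p ∂ν < ∞

/-- `ν` is a `p`-Wasserstein barycenter of the measures `μᵢ` with weights `λᵢ`: it minimizes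
`ρ ↦ ∑ᵢ λᵢ W_p(μᵢ, ρ)ᵖ` over `𝒫_p(ℝᵈ)`. -/
def IsWassersteinBarycenter {d : ℕ} {ι : Type} [Fintype ι] (p : ℝ) (lam : ι → ℝ)
    (μ : ι → Measure (EuclideanSpace ℝ (Fin d))) (ν : Measure (EuclideanSpace ℝ (Fin d))) : Prop :=
  MemProbP p ν ∧ ∀ ρ, MemProbP p ρ →
    ∑ i, ENNReal.ofReal (lam i) * wassersteinDist p (μ i) ν ^ p ≤
      ∑ i, ENNReal.ofReal (lam i) * wassersteinDist p (μ i) ρ ^ p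

/-- For Dirac masses at `x̂ᵢ`, the map `bar_p(x₁) = x̄_p(x₁, x̂₂, …, x̂_N)` (weights `λ₁, …, λ_N`);
here `N = n + 1`, index `0` stands for `1`, and `xhat i` for the point with index `i + 2`. -/
noncomputable def barMap {d n : ℕ} (p : ℝ) (lam : Fin (n + 1) → ℝ)
    (xhat : Fin n → EuclideanSpace ℝ (Fin d)) (x₁ : EuclideanSpace ℝ (Fin d)) :
    EuclideanSpace ℝ (Fin d) :=
  pBarycenter p lam (Fin.cons x₁ xhat : Fin (n + 1) → EuclideanSpace ℝ (Fin d))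

/-- The point `z̄_p = x̄_p(x̂₂, …, x̂_N)` (weights `λ₂, …, λ_N`). -/
noncomputable def zBar {d n : ℕ} (p : ℝ) (lam : Fin (n + 1) → ℝ)
    (xhat : Fin n → EuclideanSpace ℝ (Fin d)) : EuclideanSpace ℝ (Fin d) :=
  pBarycenter p (fun i : Fin n => lam i.succ) xhat

/-- The exponent `α_p = (p - 2) / (p - 1)`. -/
noncomputable def alphaExp (p : ℝ) : ℝ := (p - 2) / (p - 1)

/-! All marginals but the first are Dirac masses, so the objective at ν is the infimum, over plans
between `μ 0` and ν, of the integral of c(x, y), the `pCost` of y for the points x, x̂ᵢ. Minimizing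
in y for each x gives y = T x with T = `barMap`. Hence the image of `μ 0` under T is a barycenter,
and a uniform gap in c shows that it is the only one (`IsWassersteinBarycenter.eq_map_barMap`).

If |x - x'| ≤ L |T x - T x'| on the compact support of `μ 0`, then T⁻¹ is L-Lipschitz there, so T
concentrates volume, and raises the L^q norm of a density, by at most L^d (`exists_density_map`).

To find L, write J v = |v|^(p-2) v, z = T x and use the optimality condition λ₁ J(x - z) = ∑ λᵢ J(z
- x̂ᵢ): the right side is Lipschitz in z, and J is inverted on the left. For p > 2, J⁻¹ is not
Lipschitz near 0; but the right side vanishes at z̄_p and is uniformly monotone, so distance δ from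
z̄_p keeps x - z away from 0 (`norm_sub_le_norm_barMap_sub_of_two_le`). For p < 2 it is J that is
not Lipschitz near 0, and δ keeps z away from the x̂ᵢ (`norm_sub_le_norm_barMap_sub_of_le_two`).
Both cases give L = C λ₁^(-1/(p-1)), and 1/(p-1) = 1 - α_p. -/

/-! ### Lipschitz and monotonicity estimates for the duality map -/

section Duality

open scoped InnerProductSpace

variable {E : Type*} [NormedAddCommGroup E] [InnerProductSpace ℝ E]

/-- The duality map `v ↦ |v|^(p-2) v`, which is `1/p` times the gradient of `|v|^p`. -/
noncomputable def dualityMap (p : ℝ) (v : E) : E := ‖v‖ ^ (p - 2) • v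

theorem dualityMap_neg (p : ℝ) (v : E) : dualityMap p (-v) = -dualityMap p v := by
  simp [dualityMap]

theorem rpow_sub_two_mul_self {p t : ℝ} (hp : 1 < p) (ht : 0 ≤ t) :
    t ^ (p - 2) * t = t ^ (p - 1) := by
  rcases ht.eq_or_lt with rfl | ht
  · rw [mul_zero, Real.zero_rpow (by linarith)]
  · rw [← Real.rpow_add_one ht.ne']
    ring_nf

theorem norm_dualityMap {p : ℝ} (hp : 1 < p) (v : E) : ‖dualityMap p v‖ = ‖v‖ ^ (p - 1) := by
  rw [dualityMap, norm_smul, Real.norm_of_nonneg (by positivity),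
    rpow_sub_two_mul_self hp (norm_nonneg v)]

theorem dualityMap_conj {p : ℝ} (hp : 1 < p) (v : E) :
    dualityMap (p / (p - 1)) (dualityMap p v) = v := by
  rcases eq_or_ne v 0 with rfl | hv
  · simp [dualityMap]
  have hv' : 0 < ‖v‖ := norm_pos_iff.2 hv
  have hp' : p - 1 ≠ 0 := by linarith
  rw [dualityMap, norm_dualityMap hp, dualityMap, smul_smul, ← Real.rpow_mul hv'.le,
    ← Real.rpow_add hv']
  have : (p - 1) * (p / (p - 1) - 2) + (p - 2) = 0 := by
    field_simp
    ring
  rw [this, Real.rpow_zero, one_smul]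

/-- With |b| ≤ |a|, split off |a|^(p-2) (a - b). The remainder is a difference of weights times b,
which Bernoulli's inequality (the tangent line of t^(p-1) at |a|) controls by |a| - |b|. -/
theorem norm_dualityMap_sub_le_of_two_le {p R : ℝ} (hp : 2 ≤ p) {a b : E} (ha : ‖a‖ ≤ R)
    (hb : ‖b‖ ≤ R) :
    ‖dualityMap p a - dualityMap p b‖ ≤ (p - 1) * R ^ (p - 2) * ‖a - b‖ := by
  wlog hab : ‖b‖ ≤ ‖a‖ generalizing a b
  · rw [norm_sub_rev, norm_sub_rev a b]
    exact this hb ha (le_of_not_ge hab)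
  have hsplit : dualityMap p a - dualityMap p b =
      ‖a‖ ^ (p - 2) • (a - b) + (‖a‖ ^ (p - 2) - ‖b‖ ^ (p - 2)) • b := by
    unfold dualityMap
    module
  have hmono : ‖b‖ ^ (p - 2) ≤ ‖a‖ ^ (p - 2) :=
    Real.rpow_le_rpow (norm_nonneg _) hab (by linarith)
  have hreal : (‖a‖ ^ (p - 2) - ‖b‖ ^ (p - 2)) * ‖b‖ ≤
      (p - 2) * ‖a‖ ^ (p - 2) * (‖a‖ - ‖b‖) := by
    rcases (norm_nonneg a).eq_or_lt with h0 | h0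
    · have : ‖b‖ = 0 := le_antisymm (h0 ▸ hab) (norm_nonneg b)
      rw [← h0, this]
      simp
    have hB := one_add_mul_self_le_rpow_one_add (s := ‖b‖ / ‖a‖ - 1) (p := p - 1)
      (by have : 0 ≤ ‖b‖ / ‖a‖ := by positivity
          linarith) (by linarith)
    rw [add_sub_cancel, Real.div_rpow (norm_nonneg _) (norm_nonneg _),
      le_div_iff₀ (by positivity), ← rpow_sub_two_mul_self (by linarith) (norm_nonneg a),
      ← rpow_sub_two_mul_self (by linarith) (norm_nonneg b)] at hB
    have hexp : (1 + (p - 1) * (‖b‖ / ‖a‖ - 1)) * (‖a‖ ^ (p - 2) * ‖a‖) =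
        ‖a‖ ^ (p - 2) * (‖a‖ + (p - 1) * (‖b‖ - ‖a‖)) := by
      field_simp
    rw [hexp] at hB
    linarith
  have hsub : ‖a‖ - ‖b‖ ≤ ‖a - b‖ := norm_sub_norm_le a b
  calc ‖dualityMap p a - dualityMap p b‖
      ≤ ‖a‖ ^ (p - 2) * ‖a - b‖ + (‖a‖ ^ (p - 2) - ‖b‖ ^ (p - 2)) * ‖b‖ := by
        rw [hsplit]
        refine (norm_add_le _ _).trans_eq ?_
        rw [norm_smul, norm_smul, Real.norm_of_nonneg (by positivity),
          Real.norm_of_nonneg (by linarith)]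
    _ ≤ ‖a‖ ^ (p - 2) * ‖a - b‖ + (p - 2) * ‖a‖ ^ (p - 2) * ‖a - b‖ := by
        refine add_le_add_right (hreal.trans (mul_le_mul_of_nonneg_left hsub ?_)) _
        exact mul_nonneg (by linarith) (by positivity)
    _ = (p - 1) * ‖a‖ ^ (p - 2) * ‖a - b‖ := by ring
    _ ≤ (p - 1) * R ^ (p - 2) * ‖a - b‖ := by
        have := Real.rpow_le_rpow (norm_nonneg _) ha (by linarith : 0 ≤ p - 2)
        have : 0 ≤ p - 1 := by linarith
        gcongr

/-- For p < 2 the weight t^(p-2) blows up at 0, hence the lower bound r. The difference of weights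
is controlled by monotonicity of t^(p-1). -/
theorem norm_dualityMap_sub_le_of_le_two {p r : ℝ} (hp : 1 < p) (hp2 : p ≤ 2) (hr : 0 < r)
    {a b : E} (ha : r ≤ ‖a‖) (hb : r ≤ ‖b‖) :
    ‖dualityMap p a - dualityMap p b‖ ≤ 2 * r ^ (p - 2) * ‖a - b‖ := by
  wlog hab : ‖b‖ ≤ ‖a‖ generalizing a b
  · rw [norm_sub_rev, norm_sub_rev a b]
    exact this hb ha (le_of_not_ge hab)
  have hb0 : 0 < ‖b‖ := hr.trans_le hb
  have hsplit : dualityMap p a - dualityMap p b =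
      ‖b‖ ^ (p - 2) • (a - b) - (‖b‖ ^ (p - 2) - ‖a‖ ^ (p - 2)) • a := by
    unfold dualityMap
    module
  have hanti : ‖a‖ ^ (p - 2) ≤ ‖b‖ ^ (p - 2) :=
    Real.rpow_le_rpow_of_nonpos hb0 hab (by linarith)
  have hreal : (‖b‖ ^ (p - 2) - ‖a‖ ^ (p - 2)) * ‖a‖ ≤ ‖b‖ ^ (p - 2) * (‖a‖ - ‖b‖) := by
    have h1 := rpow_sub_two_mul_self hp (norm_nonneg a)
    have h2 := rpow_sub_two_mul_self hp (norm_nonneg b)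
    have h3 := Real.rpow_le_rpow (norm_nonneg b) hab (by linarith : 0 ≤ p - 1)
    linarith
  have hsub : ‖a‖ - ‖b‖ ≤ ‖a - b‖ := norm_sub_norm_le a b
  calc ‖dualityMap p a - dualityMap p b‖
      ≤ ‖b‖ ^ (p - 2) * ‖a - b‖ + (‖b‖ ^ (p - 2) - ‖a‖ ^ (p - 2)) * ‖a‖ := by
        rw [hsplit]
        refine (norm_sub_le _ _).trans_eq ?_
        rw [norm_smul, norm_smul, Real.norm_of_nonneg (by positivity),
          Real.norm_of_nonneg (by linarith)]
    _ ≤ ‖b‖ ^ (p - 2) * ‖a - b‖ + ‖b‖ ^ (p - 2) * ‖a - b‖ :=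
        add_le_add_right (hreal.trans (mul_le_mul_of_nonneg_left hsub (by positivity))) _
    _ = 2 * ‖b‖ ^ (p - 2) * ‖a - b‖ := by ring
    _ ≤ 2 * r ^ (p - 2) * ‖a - b‖ := by
        have := Real.rpow_le_rpow_of_nonpos hr hb (by linarith : p - 2 ≤ 0)
        gcongr

/-- The inverse of the duality map is the duality map of the conjugate exponent p/(p-1) ≥ 2, so the
Lipschitz bound for exponents at least 2 applies to the images of a and b, of norm at most R^(p-1).
-/
theorem norm_sub_le_norm_dualityMap_sub {p R : ℝ} (hp : 1 < p) (hp2 : p ≤ 2) {a b : E}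
    (ha : ‖a‖ ≤ R) (hb : ‖b‖ ≤ R) :
    ‖a - b‖ ≤ (p - 1)⁻¹ * R ^ (2 - p) * ‖dualityMap p a - dualityMap p b‖ := by
  have hp' : 0 < p - 1 := by linarith
  have hR : 0 ≤ R := (norm_nonneg a).trans ha
  have key := norm_dualityMap_sub_le_of_two_le (p := p / (p - 1)) (R := R ^ (p - 1))
    (a := dualityMap p a) (b := dualityMap p b)
    (by rw [le_div_iff₀ hp']; linarith)
    (by rw [norm_dualityMap hp]; exact Real.rpow_le_rpow (norm_nonneg _) ha hp'.le)
    (by rw [norm_dualityMap hp]; exact Real.rpow_le_rpow (norm_nonneg _) hb hp'.le)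
  rw [dualityMap_conj hp, dualityMap_conj hp, ← Real.rpow_mul hR] at key
  have h1 : p / (p - 1) - 1 = (p - 1)⁻¹ := by
    field_simp
    ring
  have h2 : (p - 1) * (p / (p - 1) - 2) = 2 - p := by
    field_simp
    ring
  rwa [h1, h2] at key

/-- The two sides differ by half of (|a|^(p-2) - |b|^(p-2)) (|a|² - |b|²), whose factors have the
same sign. -/
theorem inner_dualityMap_sub_ge {p : ℝ} (hp : 2 ≤ p) (a b : E) :
    (‖a‖ ^ (p - 2) + ‖b‖ ^ (p - 2)) / 2 * ‖a - b‖ ^ 2 ≤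
      ⟪dualityMap p a - dualityMap p b, a - b⟫_ℝ := by
  have hid : ⟪dualityMap p a - dualityMap p b, a - b⟫_ℝ =
      (‖a‖ ^ (p - 2) + ‖b‖ ^ (p - 2)) / 2 * ‖a - b‖ ^ 2 +
        (‖a‖ ^ (p - 2) - ‖b‖ ^ (p - 2)) * (‖a‖ ^ 2 - ‖b‖ ^ 2) / 2 := by
    rw [norm_sub_sq_real]
    simp only [dualityMap, inner_sub_left, inner_sub_right, inner_smul_left,
      real_inner_self_eq_norm_sq, real_inner_comm a b, RCLike.conj_to_real]
    ring
  have hnonneg : 0 ≤ (‖a‖ ^ (p - 2) - ‖b‖ ^ (p - 2)) * (‖a‖ ^ 2 - ‖b‖ ^ 2) := by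
    rcases le_total ‖a‖ ‖b‖ with h | h
    · refine mul_nonneg_of_nonpos_of_nonpos ?_ ?_
      · exact sub_nonpos.2 (Real.rpow_le_rpow (norm_nonneg _) h (by linarith))
      · exact sub_nonpos.2 (pow_le_pow_left₀ (norm_nonneg _) h 2)
    · refine mul_nonneg ?_ ?_
      · exact sub_nonneg.2 (Real.rpow_le_rpow (norm_nonneg _) h (by linarith))
      · exact sub_nonneg.2 (pow_le_pow_left₀ (norm_nonneg _) h 2)
  linarith

/-- One of |a|, |b| is at least |a - b| / 2, which makes the monotonicity uniform in a and b. -/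
theorem half_norm_rpow_le_inner_dualityMap_sub {p : ℝ} (hp : 2 ≤ p) (a b : E) :
    (‖a - b‖ / 2) ^ (p - 2) / 2 * ‖a - b‖ ^ 2 ≤ ⟪dualityMap p a - dualityMap p b, a - b⟫_ℝ := by
  refine le_trans ?_ (inner_dualityMap_sub_ge hp a b)
  refine mul_le_mul_of_nonneg_right ?_ (by positivity)
  refine div_le_div_of_nonneg_right ?_ zero_le_two
  have htri := norm_sub_le a b
  rcases le_total ‖a‖ ‖b‖ with h | h
  · have := Real.rpow_le_rpow (by positivity) (by linarith : ‖a - b‖ / 2 ≤ ‖b‖)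
      (by linarith : 0 ≤ p - 2)
    have h0 : 0 ≤ ‖a‖ ^ (p - 2) := by positivity
    linarith
  · have := Real.rpow_le_rpow (by positivity) (by linarith : ‖a - b‖ / 2 ≤ ‖a‖)
      (by linarith : 0 ≤ p - 2)
    have h0 : 0 ≤ ‖b‖ ^ (p - 2) := by positivity
    linarith

end Duality

/-! ### Optimality condition and a priori bound for Euclidean barycenters -/

section Barycenter

open scoped InnerProductSpace

variable {d : ℕ} {ι : Type} [Fintype ι] [Nonempty ι] {p : ℝ} {lam : ι → ℝ}

theorem pCost_pBarycenter_le (hp : 1 < p) (hlam : ∀ i, 0 < lam i)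
    (x : ι → EuclideanSpace ℝ (Fin d)) (w : EuclideanSpace ℝ (Fin d)) :
    pCost p lam x (pBarycenter p lam x) ≤ pCost p lam x w :=
  (pBarycenter_isUniqueMin hp hlam x _).2 rfl w

/-- The first-order optimality condition for the Euclidean `p`-barycenter. -/
theorem sum_smul_dualityMap_pBarycenter (hp : 1 < p) (hlam : ∀ i, 0 < lam i)
    (x : ι → EuclideanSpace ℝ (Fin d)) :
    ∑ i, lam i • dualityMap p (x i - pBarycenter p lam x) = 0 := by
  set z := pBarycenter p lam x
  have hderiv : HasFDerivAt (pCost p lam x)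
      (∑ i, lam i • (((p * ‖x i - z‖ ^ (p - 2)) • innerSL ℝ (x i - z)).comp
        (-(ContinuousLinearMap.id ℝ (EuclideanSpace ℝ (Fin d)))))) z := by
    unfold pCost
    refine HasFDerivAt.fun_sum fun i _ => HasFDerivAt.const_mul ?_ _
    exact HasFDerivAt.comp z (hasFDerivAt_norm_rpow (x i - z) hp)
      ((hasFDerivAt_id z).const_sub (x i))
  have hzero := IsLocalMin.hasFDerivAt_eq_zero
    (Filter.Eventually.of_forall (pCost_pBarycenter_le hp hlam x)) hderiv
  have hp0 : p ≠ 0 := by linarith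
  refine ext_inner_right ℝ fun v => ?_
  have hv := DFunLike.congr_fun hzero v
  simp only [FunLike.coe_sum, Finset.sum_apply, FunLike.coe_smul, Pi.smul_apply, smul_eq_mul,
    ContinuousLinearMap.comp_apply, neg_apply, ContinuousLinearMap.id_apply,
    innerSL_apply_apply, inner_neg_right, zero_apply] at hv
  have hrw : ∑ i, lam i * (p * ‖x i - z‖ ^ (p - 2) * -⟪x i - z, v⟫_ℝ) =
      -p * ⟪∑ i, lam i • dualityMap p (x i - z), v⟫_ℝ := by
    rw [sum_inner, Finset.mul_sum]
    refine Finset.sum_congr rfl fun i _ => ?_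
    simp only [dualityMap, inner_smul_left, RCLike.conj_to_real]
    ring
  rw [hrw] at hv
  rw [inner_zero_left]
  exact (mul_eq_zero.1 hv).resolve_left (neg_ne_zero.2 hp0)

/-- If |z| > R, every x i - z has negative inner product with z, contradicting the optimality
condition. -/
theorem norm_pBarycenter_le (hp : 1 < p) (hlam : ∀ i, 0 < lam i)
    {x : ι → EuclideanSpace ℝ (Fin d)} {R : ℝ} (hx : ∀ i, ‖x i‖ ≤ R) :
    ‖pBarycenter p lam x‖ ≤ R := by
  set z := pBarycenter p lam x with hz
  by_contra! hR
  have h0 := congrArg (fun v => ⟪v, z⟫_ℝ) (sum_smul_dualityMap_pBarycenter hp hlam x)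
  simp only [sum_inner, inner_zero_left] at h0
  refine absurd h0 (ne_of_lt (Finset.sum_neg (fun i _ => ?_) Finset.univ_nonempty))
  have hne : 0 < ‖x i - z‖ := by
    refine norm_pos_iff.2 (sub_ne_zero.2 fun h => ?_)
    have := hx i
    rw [h] at this
    linarith
  have hin : ⟪x i - z, z⟫_ℝ < 0 := by
    rw [inner_sub_left, real_inner_self_eq_norm_sq]
    have h1 := real_inner_le_norm (x i) z
    have h2 := hx i
    have h3 : 0 ≤ R := (norm_nonneg _).trans h2
    nlinarith
  rw [dualityMap, inner_smul_left, inner_smul_left, ← hz]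
  simp only [RCLike.conj_to_real]
  exact mul_neg_of_pos_of_neg (hlam i) (mul_neg_of_pos_of_neg (by positivity) hin)

end Barycenter

/-! ### The map bar_p: expansion estimates and continuity -/

section BarMap

open scoped InnerProductSpace

variable {d n : ℕ} {p : ℝ} {lam : Fin (n + 1) → ℝ} {xhat : Fin n → EuclideanSpace ℝ (Fin d)}

theorem smul_dualityMap_sub_barMap (hp : 1 < p) (hlam : ∀ i, 0 < lam i)
    (x : EuclideanSpace ℝ (Fin d)) :
    lam 0 • dualityMap p (x - barMap p lam xhat x) =
      ∑ i : Fin n, lam i.succ • dualityMap p (barMap p lam xhat x - xhat i) := by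
  have h := sum_smul_dualityMap_pBarycenter hp hlam
    (Fin.cons x xhat : Fin (n + 1) → EuclideanSpace ℝ (Fin d))
  rw [Fin.sum_univ_succ] at h
  simp only [Fin.cons_zero, Fin.cons_succ] at h
  refine (eq_neg_of_add_eq_zero_left h).trans ?_
  rw [← Finset.sum_neg_distrib]
  refine Finset.sum_congr rfl fun i _ => ?_
  rw [← smul_neg, ← dualityMap_neg, neg_sub]
  rfl

theorem sum_smul_dualityMap_zBar_sub [NeZero n] (hp : 1 < p) (hlam : ∀ i, 0 < lam i) :
    ∑ i : Fin n, lam i.succ • dualityMap p (zBar p lam xhat - xhat i) = 0 := by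
  have h := sum_smul_dualityMap_pBarycenter hp (fun i : Fin n => hlam i.succ) xhat
  rw [← neg_eq_zero, ← Finset.sum_neg_distrib, ← h]
  refine Finset.sum_congr rfl fun i _ => ?_
  rw [← smul_neg, ← dualityMap_neg, neg_sub]
  rfl

theorem norm_barMap_le (hp : 1 < p) (hlam : ∀ i, 0 < lam i) {R : ℝ} (hxhat : ∀ i, ‖xhat i‖ ≤ R)
    {x : EuclideanSpace ℝ (Fin d)} (hx : ‖x‖ ≤ R) : ‖barMap p lam xhat x‖ ≤ R := by
  refine norm_pBarycenter_le hp hlam fun i => ?_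
  refine Fin.cases ?_ (fun i => ?_) i
  · simpa using hx
  · simpa using hxhat i

/-- At z̄_p the pull of the fixed points vanishes, so the optimality condition would force x = z̄_p.
-/
theorem barMap_ne_zBar [NeZero n] (hp : 1 < p) (hlam : ∀ i, 0 < lam i)
    {x : EuclideanSpace ℝ (Fin d)} (hx : x ≠ zBar p lam xhat) :
    barMap p lam xhat x ≠ zBar p lam xhat := by
  intro h
  have h1 := smul_dualityMap_sub_barMap (xhat := xhat) hp hlam x
  rw [h, sum_smul_dualityMap_zBar_sub hp hlam, smul_eq_zero] at h1
  have h2 := h1.resolve_left (hlam 0).ne'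
  rw [← norm_eq_zero, norm_dualityMap hp, Real.rpow_eq_zero (norm_nonneg _) (by linarith),
    norm_eq_zero, sub_eq_zero] at h2
  exact hx h2

theorem norm_sum_smul_dualityMap_sub_le (hlam : ∀ i, 0 < lam i) {k : ℝ}
    {z z' : EuclideanSpace ℝ (Fin d)}
    (hk : ∀ i, ‖dualityMap p (z - xhat i) - dualityMap p (z' - xhat i)‖ ≤ k * ‖z - z'‖) :
    ‖∑ i : Fin n, lam i.succ • dualityMap p (z - xhat i) -
      ∑ i : Fin n, lam i.succ • dualityMap p (z' - xhat i)‖ ≤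
        (∑ i : Fin n, lam i.succ) * (k * ‖z - z'‖) := by
  rw [← Finset.sum_sub_distrib, Finset.sum_mul]
  refine (norm_sum_le _ _).trans (Finset.sum_le_sum fun i _ => ?_)
  rw [← smul_sub, norm_smul, Real.norm_of_nonneg (hlam _).le]
  exact mul_le_mul_of_nonneg_left (hk i) (hlam _).le

/-- The sum vanishes at z̄_p; subtract that value, pair with z - z̄_p and use uniform monotonicity.
-/
theorem norm_sum_smul_dualityMap_ge [NeZero n] (hp : 2 ≤ p) (hlam : ∀ i, 0 < lam i)
    {δ : ℝ} (hδ : 0 < δ) {z : EuclideanSpace ℝ (Fin d)} (hz : δ ≤ ‖z - zBar p lam xhat‖) :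
    (∑ i : Fin n, lam i.succ) * (δ / 2) ^ (p - 1) ≤
      ‖∑ i : Fin n, lam i.succ • dualityMap p (z - xhat i)‖ := by
  set w := z - zBar p lam xhat with hw
  have hw0 : 0 < ‖w‖ := hδ.trans_le hz
  have hlow : (∑ i : Fin n, lam i.succ) * ((‖w‖ / 2) ^ (p - 2) / 2 * ‖w‖ ^ 2) ≤
      ⟪∑ i : Fin n, lam i.succ • dualityMap p (z - xhat i), w⟫_ℝ := by
    have hsub : ∑ i : Fin n, lam i.succ • dualityMap p (z - xhat i) =
        ∑ i : Fin n, lam i.succ •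
          (dualityMap p (z - xhat i) - dualityMap p (zBar p lam xhat - xhat i)) := by
      simp only [smul_sub, Finset.sum_sub_distrib]
      rw [sum_smul_dualityMap_zBar_sub (by linarith) hlam, sub_zero]
    rw [hsub, sum_inner, Finset.sum_mul]
    refine Finset.sum_le_sum fun i _ => ?_
    rw [inner_smul_left]
    have := half_norm_rpow_le_inner_dualityMap_sub hp (z - xhat i) (zBar p lam xhat - xhat i)
    rw [sub_sub_sub_cancel_right, ← hw] at this
    exact mul_le_mul_of_nonneg_left this (hlam _).le
  have hup := real_inner_le_norm (∑ i : Fin n, lam i.succ • dualityMap p (z - xhat i)) w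
  have hs : 0 ≤ ∑ i : Fin n, lam i.succ := Finset.sum_nonneg fun i _ => (hlam _).le
  have hpow : (δ / 2) ^ (p - 1) ≤ (‖w‖ / 2) ^ (p - 1) :=
    Real.rpow_le_rpow (by positivity) (by linarith) (by linarith)
  refine (mul_le_mul_of_nonneg_left hpow hs).trans ?_
  refine le_of_mul_le_mul_right ?_ hw0
  refine le_trans (le_of_eq ?_) (hlow.trans hup)
  rw [← rpow_sub_two_mul_self (by linarith : 1 < p) (by positivity : 0 ≤ ‖w‖ / 2)]
  ring

theorem one_le_rpow_neg_inv {t : ℝ} (hp : 1 < p) (ht : 0 < t) (ht1 : t ≤ 1) :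
    1 ≤ t ^ (-(p - 1)⁻¹) :=
  Real.one_le_rpow_of_pos_of_le_one_of_nonpos ht ht1
    (neg_nonpos.2 (inv_nonneg.2 (by linarith)))

/-- Since x = (x - z) + z, only the residual x - z has to be estimated; l ≥ 1 absorbs the extra |z -
z'|. -/
theorem norm_sub_le_of_norm_residual_sub_le {x x' z z' : EuclideanSpace ℝ (Fin d)} {c l : ℝ}
    (hl : 1 ≤ l) (h : ‖(x - z) - (x' - z')‖ ≤ c * l * ‖z - z'‖) :
    ‖x - x'‖ ≤ (1 + c) * l * ‖z - z'‖ := by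
  have heq : x - x' = ((x - z) - (x' - z')) + (z - z') := by abel
  have htri := norm_add_le ((x - z) - (x' - z')) (z - z')
  rw [← heq] at htri
  have := mul_le_mul_of_nonneg_right hl (norm_nonneg (z - z'))
  linarith

/-- Bounding J u - J u' alone costs a factor s/λ₁, where u = x - z and s is the weight of the fixed
points. Monotonicity of J divides this by |u|^(p-2), and |u| is itself at least of order
(s/λ₁)^(1/(p-1)) δ; the quotient leaves only (s/λ₁)^(1/(p-1)). Only |u| enters, so only x needs the
separation. -/
theorem norm_sub_le_norm_barMap_sub_of_two_le [NeZero n] (hp : 2 ≤ p) (hlam : ∀ i, 0 < lam i)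
    (hsum : ∑ i, lam i = 1) {R : ℝ} (hxhat : ∀ i, ‖xhat i‖ ≤ R) {δ : ℝ} (hδ : 0 < δ)
    {x x' : EuclideanSpace ℝ (Fin d)} (hx : ‖x‖ ≤ R) (hx' : ‖x'‖ ≤ R)
    (hz : δ ≤ ‖barMap p lam xhat x - zBar p lam xhat‖) :
    ‖x - x'‖ ≤ (1 + 2 * (p - 1) * (2 * R) ^ (p - 2) / (δ / 2) ^ (p - 2)) *
      lam 0 ^ (-(p - 1)⁻¹) * ‖barMap p lam xhat x - barMap p lam xhat x'‖ := by
  have hp1 : 1 < p := by linarith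
  have hpm : 0 < p - 1 := by linarith
  have hR : 0 ≤ R := (norm_nonneg x).trans hx
  have h0 := hlam 0
  set s := ∑ i : Fin n, lam i.succ with hs
  have hs0 : 0 < s := Finset.sum_pos (fun i _ => hlam _) Finset.univ_nonempty
  have hs1 : lam 0 + s = 1 := by rw [← hsum, Fin.sum_univ_succ]
  have hfoc := smul_dualityMap_sub_barMap (xhat := xhat) hp1 hlam x
  have hfoc' := smul_dualityMap_sub_barMap (xhat := xhat) hp1 hlam x'
  have hzR := norm_barMap_le hp1 hlam hxhat hx
  have hzR' := norm_barMap_le hp1 hlam hxhat hx'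
  have hge := norm_sum_smul_dualityMap_ge (xhat := xhat) hp hlam hδ hz
  set z := barMap p lam xhat x
  set z' := barMap p lam xhat x'
  refine norm_sub_le_of_norm_residual_sub_le (one_le_rpow_neg_inv hp1 h0 (by linarith)) ?_
  set u := x - z with hu
  set u' := x' - z' with hu'
  set k := (p - 1) * (2 * R) ^ (p - 2) with hk
  have hk0 : 0 ≤ k := by positivity
  have hlip : lam 0 * ‖dualityMap p u - dualityMap p u'‖ ≤ s * (k * ‖z - z'‖) := by
    have := norm_sum_smul_dualityMap_sub_le (p := p) (xhat := xhat) hlam (k := k) (z := z)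
      (z' := z') fun i => by
        have h1 := norm_dualityMap_sub_le_of_two_le (R := 2 * R) hp
          (a := z - xhat i) (b := z' - xhat i)
          (by linarith [norm_sub_le z (xhat i), hxhat i])
          (by linarith [norm_sub_le z' (xhat i), hxhat i])
        rwa [sub_sub_sub_cancel_right] at h1
    rwa [← hfoc, ← hfoc', ← smul_sub, norm_smul, Real.norm_of_nonneg h0.le] at this
  -- Chosen so that r^(p-1) = s/λ₁, the scale of |J u|.
  set r := (s / lam 0) ^ (p - 1)⁻¹ with hr
  have hr0 : 0 < r := by positivity
  have hrpow : r ^ (p - 2) * r = s / lam 0 := by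
    rw [rpow_sub_two_mul_self hp1 hr0.le, hr, ← Real.rpow_mul (by positivity),
      inv_mul_cancel₀ hpm.ne', Real.rpow_one]
  have hr_le : r ≤ lam 0 ^ (-(p - 1)⁻¹) := by
    rw [Real.rpow_neg h0.le, ← Real.inv_rpow h0.le]
    refine Real.rpow_le_rpow (by positivity) ?_ (by positivity)
    rw [div_eq_mul_inv]
    exact mul_le_of_le_one_left (by positivity) (by linarith)
  have hu_ge : r * (δ / 2) ≤ ‖u‖ := by
    rw [← hfoc, norm_smul, norm_dualityMap hp1, Real.norm_of_nonneg h0.le] at hge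
    have h1 : (r * (δ / 2)) ^ (p - 1) ≤ ‖u‖ ^ (p - 1) := by
      rw [Real.mul_rpow hr0.le (by positivity), ← rpow_sub_two_mul_self hp1 hr0.le, hrpow,
        div_mul_eq_mul_div, div_le_iff₀ h0]
      linarith
    exact (Real.rpow_le_rpow_iff (by positivity) (norm_nonneg _) hpm).1 h1
  have hmono : ‖u‖ ^ (p - 2) / 2 * ‖u - u'‖ ≤ ‖dualityMap p u - dualityMap p u'‖ := by
    rcases (norm_nonneg (u - u')).eq_or_lt with h | h
    · rw [← h, mul_zero]
      positivity
    refine le_of_mul_le_mul_right ?_ h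
    refine le_trans ?_ ((inner_dualityMap_sub_ge hp u u').trans (real_inner_le_norm _ _))
    have h1 : 0 ≤ ‖u'‖ ^ (p - 2) * ‖u - u'‖ ^ 2 := by positivity
    nlinarith
  have hupow : r ^ (p - 2) * (δ / 2) ^ (p - 2) ≤ ‖u‖ ^ (p - 2) := by
    rw [← Real.mul_rpow hr0.le (by positivity)]
    exact Real.rpow_le_rpow (by positivity) hu_ge (by linarith)
  have hD : 0 < (δ / 2) ^ (p - 2) := by positivity
  have hrp : 0 < r ^ (p - 2) := by positivity
  have hmain : (r ^ (p - 2) * (δ / 2) ^ (p - 2)) * ‖u - u'‖ ≤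
      2 * (r ^ (p - 2) * r) * (k * ‖z - z'‖) := by
    rw [hrpow]
    calc (r ^ (p - 2) * (δ / 2) ^ (p - 2)) * ‖u - u'‖
        ≤ ‖u‖ ^ (p - 2) * ‖u - u'‖ := mul_le_mul_of_nonneg_right hupow (norm_nonneg _)
      _ ≤ 2 * ‖dualityMap p u - dualityMap p u'‖ := by linarith
      _ ≤ 2 * (s * (k * ‖z - z'‖) / lam 0) := by
          gcongr
          rw [le_div_iff₀ h0]
          linarith
      _ = 2 * (s / lam 0) * (k * ‖z - z'‖) := by ring
  have hfin : ‖u - u'‖ ≤ 2 * k / (δ / 2) ^ (p - 2) * r * ‖z - z'‖ := by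
    refine le_of_mul_le_mul_left ?_ (mul_pos hrp hD)
    refine hmain.trans_eq ?_
    field_simp
  refine hfin.trans ?_
  rw [hk, ← mul_assoc 2]
  gcongr

/-- Both z and z' stay δ away from every x̂ᵢ, so the right side of the optimality condition is
Lipschitz; the inverse of J is Lipschitz on bounded sets. The resulting factor 1/λ₁ is at most
λ₁^(-1/(p-1)) because 1/(p-1) ≥ 1 and λ₁ ≤ 1. -/
theorem norm_sub_le_norm_barMap_sub_of_le_two (hp : 1 < p) (hp2 : p ≤ 2)
    (hlam : ∀ i, 0 < lam i) (hsum : ∑ i, lam i = 1) {R : ℝ} (hxhat : ∀ i, ‖xhat i‖ ≤ R) {δ : ℝ}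
    (hδ : 0 < δ) {x x' : EuclideanSpace ℝ (Fin d)} (hx : ‖x‖ ≤ R) (hx' : ‖x'‖ ≤ R)
    (hz : ∀ i, δ ≤ ‖barMap p lam xhat x - xhat i‖)
    (hz' : ∀ i, δ ≤ ‖barMap p lam xhat x' - xhat i‖) :
    ‖x - x'‖ ≤ (1 + (p - 1)⁻¹ * (2 * R) ^ (2 - p) * (2 * δ ^ (p - 2))) *
      lam 0 ^ (-(p - 1)⁻¹) * ‖barMap p lam xhat x - barMap p lam xhat x'‖ := by
  have hpm : 0 < p - 1 := by linarith
  have hR : 0 ≤ R := (norm_nonneg x).trans hx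
  have h0 := hlam 0
  have hs0 : 0 ≤ ∑ i : Fin n, lam i.succ := Finset.sum_nonneg fun i _ => (hlam _).le
  have hs1 : lam 0 + ∑ i : Fin n, lam i.succ = 1 := by rw [← hsum, Fin.sum_univ_succ]
  have hfoc := smul_dualityMap_sub_barMap (xhat := xhat) hp hlam x
  have hfoc' := smul_dualityMap_sub_barMap (xhat := xhat) hp hlam x'
  have hzR := norm_barMap_le hp hlam hxhat hx
  have hzR' := norm_barMap_le hp hlam hxhat hx'
  set z := barMap p lam xhat x
  set z' := barMap p lam xhat x'
  refine norm_sub_le_of_norm_residual_sub_le (one_le_rpow_neg_inv hp h0 (by linarith)) ?_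
  set u := x - z with hu
  set u' := x' - z' with hu'
  set k := 2 * δ ^ (p - 2) with hk
  have hk0 : 0 ≤ k := by positivity
  have hlip : lam 0 * ‖dualityMap p u - dualityMap p u'‖ ≤ k * ‖z - z'‖ := by
    have := norm_sum_smul_dualityMap_sub_le (p := p) (xhat := xhat) hlam (k := k) (z := z)
      (z' := z') fun i => by
        have h1 := norm_dualityMap_sub_le_of_le_two hp hp2 hδ (hz i) (hz' i)
        rwa [sub_sub_sub_cancel_right] at h1
    rw [← hfoc, ← hfoc', ← smul_sub, norm_smul, Real.norm_of_nonneg h0.le] at this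
    exact this.trans (mul_le_of_le_one_left (by positivity) (by linarith))
  have hinv : (lam 0)⁻¹ ≤ lam 0 ^ (-(p - 1)⁻¹) := by
    rw [← Real.rpow_neg_one]
    refine Real.rpow_le_rpow_of_exponent_ge h0 (by linarith) (neg_le_neg ?_)
    exact (one_le_inv₀ hpm).2 (by linarith)
  have hJ : ‖dualityMap p u - dualityMap p u'‖ ≤ lam 0 ^ (-(p - 1)⁻¹) * (k * ‖z - z'‖) := by
    refine le_trans ?_ (mul_le_mul_of_nonneg_right hinv (by positivity))
    rw [inv_mul_eq_div, le_div_iff₀ h0]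
    linarith
  have hnorm := norm_sub_le_norm_dualityMap_sub (R := 2 * R) hp hp2 (a := u) (b := u')
    (by linarith [norm_sub_le x z]) (by linarith [norm_sub_le x' z'])
  refine hnorm.trans ?_
  calc (p - 1)⁻¹ * (2 * R) ^ (2 - p) * ‖dualityMap p u - dualityMap p u'‖
      ≤ (p - 1)⁻¹ * (2 * R) ^ (2 - p) * (lam 0 ^ (-(p - 1)⁻¹) * (k * ‖z - z'‖)) := by gcongr
    _ = (p - 1)⁻¹ * (2 * R) ^ (2 - p) * k * lam 0 ^ (-(p - 1)⁻¹) * ‖z - z'‖ := by ring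

theorem continuous_pCost_cons (hp : 0 ≤ p) :
    Continuous fun w : EuclideanSpace ℝ (Fin d) × EuclideanSpace ℝ (Fin d) =>
      pCost p lam (Fin.cons w.1 xhat : Fin (n + 1) → EuclideanSpace ℝ (Fin d)) w.2 := by
  unfold pCost
  simp only [Fin.sum_univ_succ, Fin.cons_zero, Fin.cons_succ]
  have h1 : Continuous fun w : EuclideanSpace ℝ (Fin d) × EuclideanSpace ℝ (Fin d) =>
      ‖w.1 - w.2‖ ^ p := by fun_prop (disch := assumption)
  have h2 (i : Fin n) : Continuous fun w : EuclideanSpace ℝ (Fin d) × EuclideanSpace ℝ (Fin d) =>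
      ‖xhat i - w.2‖ ^ p := by fun_prop (disch := assumption)
  fun_prop

/-- The values are locally bounded, and a cluster point at x₀ minimizes the cost of x₀ by passage to
the limit in the minimality inequality; uniqueness of the minimizer identifies it. -/
theorem continuous_barMap (hp : 1 < p) (hlam : ∀ i, 0 < lam i) :
    Continuous (barMap p lam xhat) := by
  refine continuous_iff_continuousAt.2 fun x₀ => ?_
  obtain ⟨R, hR⟩ := (Set.finite_range fun i => ‖xhat i‖).bddAbove
  have hxhat : ∀ i, ‖xhat i‖ ≤ max R (‖x₀‖ + 1) := fun i =>
    (hR ⟨i, rfl⟩).trans (le_max_left _ _)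
  refine IsCompact.tendsto_nhds_of_unique_mapClusterPt
    (isCompact_closedBall (0 : EuclideanSpace ℝ (Fin d)) (max R (‖x₀‖ + 1))) ?_ ?_
  · filter_upwards [Metric.ball_mem_nhds x₀ one_pos] with x hx
    rw [mem_closedBall_zero_iff]
    refine norm_barMap_le hp hlam hxhat (le_max_of_le_right ?_)
    rw [mem_ball_iff_norm] at hx
    linarith [norm_le_insert' x x₀]
  · intro z _ hz
    obtain ⟨U, hU, hUz⟩ := mapClusterPt_iff_ultrafilter.1 hz
    refine (pBarycenter_isUniqueMin hp hlam
      (Fin.cons x₀ xhat : Fin (n + 1) → EuclideanSpace ℝ (Fin d)) z).1 fun w => ?_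
    have hc := continuous_pCost_cons (lam := lam) (xhat := xhat) (zero_le_one.trans hp.le)
    have h1 := (hc.tendsto (x₀, z)).comp (Filter.Tendsto.prodMk_nhds (Filter.tendsto_id'.2 hU) hUz)
    have h2 := (hc.tendsto (x₀, w)).comp
      (Filter.Tendsto.prodMk_nhds (Filter.tendsto_id'.2 hU) (tendsto_const_nhds (x := w)))
    exact le_of_tendsto_of_tendsto' h1 h2 fun x => pCost_pBarycenter_le hp hlam _ w

end BarMap

/-! ### Densities of images under expanding maps -/

section Pushforward

variable {d : ℕ}

/-- Volume is a constant multiple of d-dimensional Hausdorff measure, for which the bound is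
immediate; the constant cancels. -/
theorem volume_image_le_of_lipschitzOnWith {S : EuclideanSpace ℝ (Fin d) → EuclideanSpace ℝ (Fin d)}
    {s : Set (EuclideanSpace ℝ (Fin d))} {L : NNReal} (hS : LipschitzOnWith L S s) :
    volume (S '' s) ≤ (L : ℝ≥0∞) ^ d * volume s := by
  have hH := isAddHaarMeasure_hausdorffMeasure (E := EuclideanSpace ℝ (Fin d))
  rw [finrank_euclideanSpace_fin] at hH
  have hvol := Measure.isAddLeftInvariant_eq_smul
    (volume : Measure (EuclideanSpace ℝ (Fin d))) (Measure.hausdorffMeasure (d : ℝ))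
  have hle := hS.hausdorffMeasure_image_le (d := d) d.cast_nonneg
  rw [ENNReal.rpow_natCast] at hle
  rw [hvol, Measure.smul_apply, Measure.smul_apply, ENNReal.smul_def, ENNReal.smul_def,
    smul_eq_mul, smul_eq_mul, mul_left_comm]
  exact mul_le_mul_right hle _

/-- A map that contracts distances on `K` by at most a factor `L` concentrates the volume of `K` by
at most a factor `L ^ d`. -/
theorem map_volume_restrict_le {T : EuclideanSpace ℝ (Fin d) → EuclideanSpace ℝ (Fin d)}
    (hT : Measurable T) {K : Set (EuclideanSpace ℝ (Fin d))} {L : NNReal}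
    (hL : ∀ x ∈ K, ∀ y ∈ K, edist x y ≤ L * edist (T x) (T y)) :
    (volume.restrict K).map T ≤ ((L : ℝ≥0∞) ^ d) • volume := by
  have hinj : Set.InjOn T K := fun x hx y hy h => by
    have := hL x hx y hy
    rwa [h, edist_self, mul_zero, nonpos_iff_eq_zero, edist_eq_zero] at this
  refine Measure.le_iff.2 fun A hA => ?_
  rw [Measure.map_apply hT hA, Measure.restrict_apply (hT hA), Measure.smul_apply, smul_eq_mul]
  set S := Function.invFunOn T K
  have hS : ∀ x ∈ K, S (T x) = x := fun x hx => hinj.leftInvOn_invFunOn hx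
  have hlip : LipschitzOnWith L S (T '' (T ⁻¹' A ∩ K)) := by
    rintro _ ⟨x, hx, rfl⟩ _ ⟨y, hy, rfl⟩
    rw [hS x hx.2, hS y hy.2]
    exact hL x hx.2 y hy.2
  have himg : S '' (T '' (T ⁻¹' A ∩ K)) = T ⁻¹' A ∩ K := by
    rw [Set.image_image]
    exact (Set.image_congr fun x hx => hS x hx.2).trans (Set.image_id' _)
  calc volume (T ⁻¹' A ∩ K) = volume (S '' (T '' (T ⁻¹' A ∩ K))) := by rw [himg]
    _ ≤ (L : ℝ≥0∞) ^ d * volume (T '' (T ⁻¹' A ∩ K)) := volume_image_le_of_lipschitzOnWith hlip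
    _ ≤ (L : ℝ≥0∞) ^ d * volume A := by
        gcongr
        rintro _ ⟨x, hx, rfl⟩
        exact hx.1

/-- The inverse is Lipschitz on T(K) and extends to a Lipschitz, hence measurable, map of the whole
space. -/
theorem exists_measurable_leftInvOn {T : EuclideanSpace ℝ (Fin d) → EuclideanSpace ℝ (Fin d)}
    {K : Set (EuclideanSpace ℝ (Fin d))} {L : NNReal}
    (hL : ∀ x ∈ K, ∀ y ∈ K, edist x y ≤ L * edist (T x) (T y)) :
    ∃ S : EuclideanSpace ℝ (Fin d) → EuclideanSpace ℝ (Fin d),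
      Measurable S ∧ ∀ x ∈ K, S (T x) = x := by
  have hinj : Set.InjOn T K := fun x hx y hy h => by
    have := hL x hx y hy
    rwa [h, edist_self, mul_zero, nonpos_iff_eq_zero, edist_eq_zero] at this
  have hS : ∀ x ∈ K, Function.invFunOn T K (T x) = x := fun x hx => hinj.leftInvOn_invFunOn hx
  have hlip : LipschitzOnWith L (Function.invFunOn T K) (T '' K) := by
    rintro _ ⟨x, hx, rfl⟩ _ ⟨y, hy, rfl⟩
    rw [hS x hx, hS y hy]
    exact hL x hx y hy
  obtain ⟨S, hSlip, hSeq⟩ := hlip.extend_finite_dimension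
  exact ⟨S, hSlip.continuous.measurable, fun x hx =>
    (hSeq (Set.mem_image_of_mem T hx)).symm.trans (hS x hx)⟩

theorem rnDeriv_le_of_le_smul {α : Type*} {mα : MeasurableSpace α} {m v : Measure α} [SigmaFinite v]
    {c : ℝ≥0∞} (h : m ≤ c • v) : m.rnDeriv v ≤ᵐ[v] fun _ => c := by
  refine ae_le_of_forall_setLIntegral_le_of_sigmaFinite (Measure.measurable_rnDeriv m v)
    fun s hs _ => ?_
  rw [setLIntegral_const]
  exact (Measure.setLIntegral_rnDeriv_le s).trans (h s)

theorem map_withDensity_comp {α β : Type*} {mα : MeasurableSpace α} {mβ : MeasurableSpace β}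
    {m : Measure α} {T : α → β} (hT : Measurable T) {φ : β → ℝ≥0∞} (hφ : Measurable φ) :
    (m.withDensity (φ ∘ T)).map T = (m.map T).withDensity φ := by
  ext A hA
  rw [Measure.map_apply hT hA, withDensity_apply _ (hT hA), withDensity_apply _ hA,
    setLIntegral_map hA hφ hT]
  rfl

/-- `L^q` norms with respect to the reference measure `v` of a function multiplied by a bounded
density. -/
theorem eLpNorm_mul_density_le {α : Type*} {mα : MeasurableSpace α} {v : Measure α}
    {F : α → ℝ} (hF : Measurable F) {h : α → ℝ≥0∞} (hh : Measurable h) {c q : ℝ≥0∞}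
    (hc : 1 ≤ c) (hc' : c ≠ ∞) (hhc : h ≤ᵐ[v] fun _ => c) (hq : 1 ≤ q) :
    eLpNorm (fun x => F x * (h x).toReal) q v ≤ c * eLpNorm F q (v.withDensity h) := by
  have henorm : ∀ᵐ x ∂v, ‖F x * (h x).toReal‖ₑ = ‖F x‖ₑ * h x := by
    filter_upwards [hhc] with x hx
    rw [enorm_mul, Real.enorm_eq_ofReal ENNReal.toReal_nonneg,
      ENNReal.ofReal_toReal (ne_top_of_le_ne_top hc' hx)]
  rcases eq_or_ne q ∞ with rfl | hq'
  · rw [eLpNorm_exponent_top, eLpNorm_exponent_top]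
    refine eLpNormEssSup_le_of_ae_enorm_bound ?_
    have hF' : ∀ᵐ x ∂(v.withDensity h), ‖F x‖ₑ ≤ eLpNormEssSup F (v.withDensity h) :=
      enorm_ae_le_eLpNormEssSup F _
    rw [ae_withDensity_iff hh] at hF'
    filter_upwards [hF', henorm, hhc] with x hx hx' hxc
    rw [hx']
    rcases eq_or_ne (h x) 0 with h0 | h0
    · simp [h0]
    · rw [mul_comm]
      exact mul_le_mul' hxc (hx h0)
  · have hq0 : q ≠ 0 := (zero_lt_one.trans_le hq).ne'
    have hqr : 1 ≤ q.toReal := by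
      rw [← ENNReal.toReal_one]
      exact ENNReal.toReal_mono hq' hq
    have hqr0 : 0 < q.toReal := zero_lt_one.trans_le hqr
    rw [eLpNorm_eq_lintegral_rpow_enorm_toReal hq0 hq',
      eLpNorm_eq_lintegral_rpow_enorm_toReal hq0 hq']
    have hcq : c = (c ^ q.toReal) ^ (1 / q.toReal) := by
      rw [← ENNReal.rpow_mul, mul_one_div_cancel hqr0.ne', ENNReal.rpow_one]
    nth_rewrite 1 [hcq]
    rw [← ENNReal.mul_rpow_of_nonneg _ _ (by positivity)]
    refine ENNReal.rpow_le_rpow ?_ (by positivity)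
    rw [lintegral_withDensity_eq_lintegral_mul v hh (by fun_prop),
      ← lintegral_const_mul _ (by fun_prop)]
    refine lintegral_mono_ae ?_
    filter_upwards [henorm, hhc] with x hx hxc
    rw [hx, ENNReal.mul_rpow_of_nonneg _ _ hqr0.le, Pi.mul_apply, mul_comm, ← mul_assoc]
    refine mul_le_mul_left ?_ _
    -- The pointwise claim is h^q ≤ c^q h: if h ≤ 1 then h^q ≤ h and c ≥ 1; otherwise h^q ≤ c^q and
    -- h ≥ 1.
    rcases le_total (h x) 1 with h1 | h1
    · refine (ENNReal.rpow_le_self_of_le_one h1 hqr).trans ?_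
      exact le_mul_of_one_le_left' (ENNReal.one_le_rpow hc hqr0)
    · exact (ENNReal.rpow_le_rpow hxc hqr0.le).trans (le_mul_of_one_le_right' h1)

/-- If `T` contracts distances on a bounded closed set `K` carrying `f` by at most a factor `L`,
then the image of `f` under `T` has a density whose `L^q` norm grows by at most `L ^ d`. -/
theorem exists_density_map {T : EuclideanSpace ℝ (Fin d) → EuclideanSpace ℝ (Fin d)}
    (hT : Measurable T) {K : Set (EuclideanSpace ℝ (Fin d))} (hK : IsCompact K) {L : NNReal}
    (hL1 : 1 ≤ L) (hL : ∀ x ∈ K, ∀ y ∈ K, edist x y ≤ L * edist (T x) (T y))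
    {f : EuclideanSpace ℝ (Fin d) → ℝ} (hf0 : 0 ≤ᵐ[volume] f) {q : ℝ≥0∞} (hq : 1 ≤ q)
    (hf : MemLp f q volume) :
    ∃ g : EuclideanSpace ℝ (Fin d) → ℝ, 0 ≤ᵐ[volume] g ∧
      ((volume.withDensity fun x => ENNReal.ofReal (f x)).restrict K).map T =
        volume.withDensity (fun x => ENNReal.ofReal (g x)) ∧
      MemLp g q volume ∧ eLpNorm g q volume ≤ (L : ℝ≥0∞) ^ d * eLpNorm f q volume := by
  obtain ⟨S, hSm, hS⟩ := exists_measurable_leftInvOn hL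
  have hfm := hf.aestronglyMeasurable
  -- A nonnegative Borel representative of f, so that its composition with S is measurable.
  set φ : EuclideanSpace ℝ (Fin d) → ℝ := fun x => max (hfm.mk f x) 0 with hφ
  have hφm : Measurable φ := hfm.stronglyMeasurable_mk.measurable.max measurable_const
  have hfφ : f =ᵐ[volume] φ := by
    filter_upwards [hfm.ae_eq_mk, hf0] with x hx hx0
    simp only [hφ]
    rw [← hx]
    exact (max_eq_left hx0).symm
  set m := (volume.restrict K).map T with hm
  have hmle : m ≤ ((L : ℝ≥0∞) ^ d) • volume := map_volume_restrict_le hT hL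
  have : IsFiniteMeasure (volume.restrict K) := ⟨by simpa using hK.measure_lt_top⟩
  set h := m.rnDeriv volume with hh
  have hhm : Measurable h := Measure.measurable_rnDeriv _ _
  have hmh : volume.withDensity h = m := Measure.withDensity_rnDeriv_eq _ _
    ((Measure.absolutelyContinuous_of_le hmle).trans Measure.smul_absolutelyContinuous)
  have hhle : h ≤ᵐ[volume] fun _ => (L : ℝ≥0∞) ^ d := rnDeriv_le_of_le_smul hmle
  have hLd : (L : ℝ≥0∞) ^ d ≠ ∞ := ENNReal.pow_ne_top ENNReal.coe_ne_top
  have hSK : ∀ᵐ x ∂volume.restrict K, S (T x) = x :=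
    (ae_restrict_iff' hK.measurableSet).2 (Filter.Eventually.of_forall hS)
  have hnorm : eLpNorm (fun x => φ (S x) * (h x).toReal) q volume ≤
      (L : ℝ≥0∞) ^ d * eLpNorm f q volume := by
    refine (eLpNorm_mul_density_le (hφm.comp hSm) hhm
      (one_le_pow₀ (by exact_mod_cast hL1)) hLd hhle hq).trans ?_
    refine mul_le_mul_right ?_ _
    have hcomp : (φ ∘ S) ∘ T =ᵐ[volume.restrict K] φ := hSK.mono fun x hx => congrArg φ hx
    rw [hmh, hm, eLpNorm_map_measure (hφm.comp hSm).aestronglyMeasurable hT.aemeasurable,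
      eLpNorm_congr_ae hcomp, eLpNorm_congr_ae hfφ]
    exact eLpNorm_mono_measure _ Measure.restrict_le_self
  -- Change of variables without a Jacobian: f transported by the inverse S, times the density h of
  -- the image of volume on K.
  refine ⟨fun x => φ (S x) * (h x).toReal, Filter.Eventually.of_forall fun x =>
    mul_nonneg (le_max_right _ _) ENNReal.toReal_nonneg, ?_, ⟨?_, ?_⟩, hnorm⟩
  · have h1 : (fun x => ENNReal.ofReal (φ (S x) * (h x).toReal)) =ᵐ[volume]
        h * fun x => ENNReal.ofReal (φ (S x)) := by
      filter_upwards [hhle] with x hx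
      rw [ENNReal.ofReal_mul (le_max_right _ _),
        ENNReal.ofReal_toReal (ne_top_of_le_ne_top hLd hx), mul_comm, Pi.mul_apply]
    have hφS : Measurable fun x => ENNReal.ofReal (φ (S x)) :=
      (hφm.comp hSm).ennreal_ofReal
    rw [withDensity_congr_ae h1, withDensity_mul _ hhm hφS, hmh, hm,
      ← map_withDensity_comp hT hφS, restrict_withDensity hK.measurableSet]
    congr 1
    refine withDensity_congr_ae ?_
    filter_upwards [hSK, ae_restrict_of_ae hfφ] with x hx hx'
    rw [Function.comp_apply, hx, hx']
  · exact ((hφm.comp hSm).mul hhm.ennreal_toReal).aestronglyMeasurable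
  · exact hnorm.trans_lt (ENNReal.mul_lt_top hLd.lt_top hf.2)

end Pushforward

/-! ### Convexity of the cost -/

section Gap

variable {d : ℕ} {ι : Type} [Fintype ι] {p : ℝ} {lam : ι → ℝ}

theorem pCost_midpoint_lt [Nonempty ι] (hp : 1 < p) (hlam : ∀ i, 0 < lam i)
    (x : ι → EuclideanSpace ℝ (Fin d)) {y z : EuclideanSpace ℝ (Fin d)} (hyz : y ≠ z) :
    pCost p lam x ((1 / 2 : ℝ) • (y + z)) <
      (1 / 2 : ℝ) * pCost p lam x y + (1 / 2 : ℝ) * pCost p lam x z := by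
  unfold pCost
  rw [Finset.mul_sum, Finset.mul_sum, ← Finset.sum_add_distrib]
  refine Finset.sum_lt_sum_of_nonempty Finset.univ_nonempty fun i _ => ?_
  have hi : x i - (1 / 2 : ℝ) • (y + z) = (1 / 2 : ℝ) • ((x i - y) + (x i - z)) := by
    module
  rw [hi]
  have := mul_lt_mul_of_pos_left (norm_rpow_midpoint_lt hp
    (a := x i - y) (b := x i - z) fun h => hyz (sub_right_injective h)) (hlam i)
  linarith

theorem pCost_nonneg (hlam : ∀ i, 0 < lam i) (x : ι → EuclideanSpace ℝ (Fin d))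
    (z : EuclideanSpace ℝ (Fin d)) : 0 ≤ pCost p lam x z :=
  Finset.sum_nonneg fun i _ => mul_nonneg (hlam i).le (by positivity)

theorem convexOn_pCost (hp : 1 < p) (hlam : ∀ i, 0 < lam i) (x : ι → EuclideanSpace ℝ (Fin d)) :
    ConvexOn ℝ Set.univ (pCost p lam x) := by
  refine ⟨convex_univ, fun y _ z _ a b ha hb hab => ?_⟩
  unfold pCost
  rw [smul_eq_mul, smul_eq_mul, Finset.mul_sum, Finset.mul_sum, ← Finset.sum_add_distrib]
  refine Finset.sum_le_sum fun i _ => ?_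
  have hi : x i - (a • y + b • z) = a • (x i - y) + b • (x i - z) := by
    rw [smul_sub, smul_sub, sub_add_sub_comm, ← add_smul, hab, one_smul]
  have htri : ‖x i - (a • y + b • z)‖ ≤ a * ‖x i - y‖ + b * ‖x i - z‖ := by
    rw [hi]
    refine (norm_add_le _ _).trans_eq ?_
    rw [norm_smul, norm_smul, Real.norm_of_nonneg ha, Real.norm_of_nonneg hb]
  have h1 := Real.rpow_le_rpow (norm_nonneg _) htri (by linarith : 0 ≤ p)
  have h2 := (convexOn_rpow hp.le).2 (norm_nonneg (x i - y) : ‖x i - y‖ ∈ Set.Ici 0)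
    (norm_nonneg (x i - z) : ‖x i - z‖ ∈ Set.Ici 0) ha hb hab
  simp only [smul_eq_mul] at h2
  have := mul_le_mul_of_nonneg_left (h1.trans h2) (hlam i).le
  linarith

end Gap

/-! ### Existence and uniqueness of the Wasserstein barycenter -/

section Optimality

variable {d n : ℕ} {p : ℝ} {lam : Fin (n + 1) → ℝ} {xhat : Fin n → EuclideanSpace ℝ (Fin d)}

/-- For a family of strictly convex functions depending continuously on a parameter, points at
distance at least `r` from the minimizer have a value exceeding the minimum by a definite amount,
uniformly over bounded parameters with bounded minimizers. -/
theorem exists_gap_of_midpoint_lt {E : Type*} [NormedAddCommGroup E] [NormedSpace ℝ E]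
    [ProperSpace E] {c : E → E → ℝ} (hc : Continuous fun w : E × E => c w.1 w.2)
    (hconv : ∀ x, ConvexOn ℝ Set.univ (c x))
    (hmid : ∀ x y z, y ≠ z →
      c x ((1 / 2 : ℝ) • (y + z)) < (1 / 2 : ℝ) * c x y + (1 / 2 : ℝ) * c x z)
    {T : E → E} (hT : ∀ x w, c x (T x) ≤ c x w) {R : ℝ} (hTR : ∀ x, ‖x‖ ≤ R → ‖T x‖ ≤ R)
    {r : ℝ} (hr : 0 < r) :
    ∃ κ > 0, ∀ x, ‖x‖ ≤ R → ∀ y, r ≤ ‖y - T x‖ → c x (T x) + κ ≤ c x y := by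
  -- The midpoint convexity defect of c x between z and z + v. It is continuous and positive on the
  -- compact set |x| ≤ R, |z| ≤ R, |v| = r, which yields κ.
  let D : E × E × E → ℝ := fun w => (1 / 2 : ℝ) * c w.1 (w.2.1 + w.2.2) +
    (1 / 2 : ℝ) * c w.1 w.2.1 - c w.1 ((1 / 2 : ℝ) • ((w.2.1 + w.2.2) + w.2.1))
  have hD : Continuous D := by
    have h1 : Continuous fun w : E × E × E => c w.1 (w.2.1 + w.2.2) :=
      hc.comp (f := fun w : E × E × E => (w.1, w.2.1 + w.2.2)) (by fun_prop)
    have h2 : Continuous fun w : E × E × E => c w.1 w.2.1 :=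
      hc.comp (f := fun w : E × E × E => (w.1, w.2.1)) (by fun_prop)
    have h3 : Continuous fun w : E × E × E => c w.1 ((1 / 2 : ℝ) • ((w.2.1 + w.2.2) + w.2.1)) :=
      hc.comp (f := fun w : E × E × E => (w.1, (1 / 2 : ℝ) • ((w.2.1 + w.2.2) + w.2.1)))
        (by fun_prop)
    exact ((h1.const_mul _).add (h2.const_mul _)).sub h3
  have hQ : IsCompact (Metric.closedBall (0 : E) R ×ˢ
      (Metric.closedBall (0 : E) R ×ˢ Metric.sphere (0 : E) r)) :=
    (isCompact_closedBall _ _).prod ((isCompact_closedBall _ _).prod (isCompact_sphere _ _))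
  obtain ⟨κ, hκ, hκD⟩ := hQ.exists_forall_le' hD.continuousOn (a := 0) (by
    rintro ⟨x, z, v⟩ ⟨_, _, hv⟩
    have hv0 : v ≠ 0 := by
      rintro rfl
      exact hr.ne (by simpa using hv)
    exact sub_pos.2 (hmid _ _ _ (by simpa using hv0)))
  refine ⟨κ, hκ, fun x hx y hy => ?_⟩
  have hzR := hTR x hx
  have hmin := hT x
  set z := T x
  set t := ‖y - z‖ with ht
  have ht0 : 0 < t := hr.trans_le hy
  have hrt : r / t ≤ 1 := (div_le_one ht0).2 hy
  have h1 : κ ≤ (1 / 2 : ℝ) * c x (z + (r / t) • (y - z)) + (1 / 2 : ℝ) * c x z -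
      c x ((1 / 2 : ℝ) • ((z + (r / t) • (y - z)) + z)) :=
    -- A distant y is replaced by the point of the segment from z to y at distance r from z; by
    -- convexity and minimality of z its cost is at most that of y.
    hκD (x, z, (r / t) • (y - z)) ⟨mem_closedBall_zero_iff.2 hx,
      mem_closedBall_zero_iff.2 hzR, by
        rw [mem_sphere_zero_iff_norm, norm_smul, Real.norm_of_nonneg (by positivity), ← ht,
          div_mul_cancel₀ _ ht0.ne']⟩
  have h2 := hmin ((1 / 2 : ℝ) • ((z + (r / t) • (y - z)) + z))
  have h3 := (hconv x).2 (Set.mem_univ z) (Set.mem_univ y) (sub_nonneg.2 hrt)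
    (by positivity : 0 ≤ r / t) (by ring)
  have h4 : (1 - r / t) • z + (r / t) • y = z + (r / t) • (y - z) := by module
  rw [h4, smul_eq_mul, smul_eq_mul] at h3
  have h5 : (1 - r / t) * c x z ≤ (1 - r / t) * c x y :=
    mul_le_mul_of_nonneg_left (hmin y) (sub_nonneg.2 hrt)
  linarith

theorem exists_pCost_gap (hp : 1 < p) (hlam : ∀ i, 0 < lam i) {R : ℝ} (hxhat : ∀ i, ‖xhat i‖ ≤ R)
    {r : ℝ} (hr : 0 < r) :
    ∃ κ > 0, ∀ x : EuclideanSpace ℝ (Fin d), ‖x‖ ≤ R → ∀ y, r ≤ ‖y - barMap p lam xhat x‖ →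
      pCost p lam (Fin.cons x xhat : Fin (n + 1) → EuclideanSpace ℝ (Fin d))
        (barMap p lam xhat x) + κ ≤
      pCost p lam (Fin.cons x xhat : Fin (n + 1) → EuclideanSpace ℝ (Fin d)) y :=
  exists_gap_of_midpoint_lt
    (c := fun x y => pCost p lam (Fin.cons x xhat : Fin (n + 1) → EuclideanSpace ℝ (Fin d)) y)
    (continuous_pCost_cons (zero_le_one.trans hp.le)) (fun _ => convexOn_pCost hp hlam _)
    (fun _ _ _ => pCost_midpoint_lt hp hlam _) (fun _ => pCost_pBarycenter_le hp hlam _)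
    (fun _ => norm_barMap_le hp hlam hxhat) hr

theorem wassersteinDist_rpow (hp : 0 < p) (μ ν : Measure (EuclideanSpace ℝ (Fin d))) :
    wassersteinDist p μ ν ^ p =
      ⨅ (π : Measure (EuclideanSpace ℝ (Fin d) × EuclideanSpace ℝ (Fin d)))
        (_ : IsTransportPlan μ ν π), ∫⁻ w, edist w.1 w.2 ^ p ∂π := by
  rw [wassersteinDist, ← ENNReal.rpow_mul, one_div_mul_cancel hp.ne', ENNReal.rpow_one]

/-- Every plan from a Dirac mass is concentrated on first coordinate a, so all plans have the same
cost; the product plan shows that there is one. -/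
theorem wassersteinDist_dirac_rpow (hp : 0 < p) (a : EuclideanSpace ℝ (Fin d))
    (ρ : Measure (EuclideanSpace ℝ (Fin d))) [IsProbabilityMeasure ρ] :
    wassersteinDist p (Measure.dirac a) ρ ^ p = ∫⁻ y, edist a y ^ p ∂ρ := by
  have key (π : Measure (EuclideanSpace ℝ (Fin d) × EuclideanSpace ℝ (Fin d)))
      (hπ : IsTransportPlan (Measure.dirac a) ρ π) :
      ∫⁻ w, edist w.1 w.2 ^ p ∂π = ∫⁻ y, edist a y ^ p ∂ρ := by
    have hae : ∀ᵐ w ∂π, w.1 = a := by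
      have h1 : ∀ᵐ x ∂π.fst, x = a := by
        rw [hπ.1, ae_dirac_iff (measurableSet_eq)]
      exact ae_of_ae_map measurable_fst.aemeasurable h1
    rw [← hπ.2, Measure.snd, lintegral_map (by fun_prop) measurable_snd]
    exact lintegral_congr_ae (hae.mono fun w hw => by simp only [hw])
  rw [wassersteinDist_rpow hp]
  refine le_antisymm ?_ (le_iInf₂ fun π hπ => (key π hπ).ge)
  have hprod : IsTransportPlan (Measure.dirac a) ρ ((Measure.dirac a).prod ρ) :=
    ⟨Measure.fst_prod, Measure.snd_prod⟩
  exact (iInf₂_le _ hprod).trans_eq (key _ hprod)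

/-- The cost of a coupling `π` of `μ₁` and `ρ` in the multi-marginal formulation. -/
theorem lintegral_pCost_cons (hp : 0 < p) (hlam : ∀ i, 0 < lam i)
    {μ₁ ρ : Measure (EuclideanSpace ℝ (Fin d))}
    {π : Measure (EuclideanSpace ℝ (Fin d) × EuclideanSpace ℝ (Fin d))}
    (hπ : IsTransportPlan μ₁ ρ π) :
    ∫⁻ w, ENNReal.ofReal
      (pCost p lam (Fin.cons w.1 xhat : Fin (n + 1) → EuclideanSpace ℝ (Fin d)) w.2) ∂π =
      ENNReal.ofReal (lam 0) * ∫⁻ w, edist w.1 w.2 ^ p ∂π +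
        ∑ i : Fin n, ENNReal.ofReal (lam i.succ) * ∫⁻ y, edist (xhat i) y ^ p ∂ρ := by
  have hterm (i : Fin (n + 1)) (a b : EuclideanSpace ℝ (Fin d)) :
      ENNReal.ofReal (lam i * ‖a - b‖ ^ p) = ENNReal.ofReal (lam i) * edist a b ^ p := by
    rw [ENNReal.ofReal_mul (hlam i).le, edist_dist, dist_eq_norm,
      ENNReal.ofReal_rpow_of_nonneg (norm_nonneg _) hp.le]
  have hpt (w : EuclideanSpace ℝ (Fin d) × EuclideanSpace ℝ (Fin d)) : ENNReal.ofReal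
      (pCost p lam (Fin.cons w.1 xhat : Fin (n + 1) → EuclideanSpace ℝ (Fin d)) w.2) =
      ENNReal.ofReal (lam 0) * edist w.1 w.2 ^ p +
        ∑ i : Fin n, ENNReal.ofReal (lam i.succ) * edist (xhat i) w.2 ^ p := by
    rw [pCost, ENNReal.ofReal_sum_of_nonneg fun i _ => mul_nonneg (hlam i).le (by positivity),
      Fin.sum_univ_succ]
    simp only [hterm, Fin.cons_zero, Fin.cons_succ]
  simp only [hpt]
  rw [lintegral_add_left (by fun_prop), lintegral_const_mul _ (by fun_prop),
    lintegral_finsetSum _ (by fun_prop)]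
  congr 1
  refine Finset.sum_congr rfl fun i _ => ?_
  rw [lintegral_const_mul _ (by fun_prop), ← hπ.2, Measure.snd,
    lintegral_map (by fun_prop) measurable_snd]

/-- The Dirac terms do not depend on the plan, so they can be moved inside the infimum defining the
first term. -/
theorem sum_wassersteinDist_rpow_eq_iInf (hp : 0 < p) (hlam : ∀ i, 0 < lam i)
    {μ : Fin (n + 1) → Measure (EuclideanSpace ℝ (Fin d))}
    (hμ : ∀ i : Fin n, μ i.succ = Measure.dirac (xhat i))
    (ρ : Measure (EuclideanSpace ℝ (Fin d))) [IsProbabilityMeasure ρ] :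
    ∑ i, ENNReal.ofReal (lam i) * wassersteinDist p (μ i) ρ ^ p =
      ⨅ π : {π // IsTransportPlan (μ 0) ρ π}, ∫⁻ w, ENNReal.ofReal
        (pCost p lam (Fin.cons w.1 xhat : Fin (n + 1) → EuclideanSpace ℝ (Fin d)) w.2) ∂π.1 := by
  rw [Fin.sum_univ_succ, wassersteinDist_rpow hp, iInf_subtype',
    ENNReal.mul_iInf_of_ne (ENNReal.ofReal_pos.2 (hlam 0)).ne' ENNReal.ofReal_ne_top,
    ENNReal.iInf_add]
  refine iInf_congr fun π => ?_
  rw [lintegral_pCost_cons hp hlam π.2]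
  congr 1
  exact Finset.sum_congr rfl fun i _ => by rw [hμ i, wassersteinDist_dirac_rpow hp]

theorem isTransportPlan_graph (μ₁ : Measure (EuclideanSpace ℝ (Fin d)))
    {T : EuclideanSpace ℝ (Fin d) → EuclideanSpace ℝ (Fin d)} (hT : Measurable T) :
    IsTransportPlan μ₁ (μ₁.map T) (μ₁.map fun x => (x, T x)) := by
  refine ⟨?_, ?_⟩
  · rw [Measure.fst, Measure.map_map measurable_fst (by fun_prop)]
    exact Measure.map_id
  · rw [Measure.snd, Measure.map_map measurable_snd (by fun_prop)]
    rfl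

/-- Inner regularity by closed sets gives ν ≤ ρ, and the total masses agree. -/
theorem measure_eq_of_forall_isClosed_le {ν ρ : Measure (EuclideanSpace ℝ (Fin d))}
    [IsProbabilityMeasure ν] [IsProbabilityMeasure ρ] (h : ∀ F, IsClosed F → ν F ≤ ρ F) :
    ν = ρ := by
  refine Measure.eq_of_le_of_isProbabilityMeasure (Measure.le_iff.2 fun A hA => ?_)
  rw [hA.measure_eq_iSup_isClosed_of_ne_top (measure_ne_top ν A)]
  exact iSup₂_le fun F hFA => iSup_le fun hF => (h F hF).trans (measure_mono hFA)

variable {μ : Fin (n + 1) → Measure (EuclideanSpace ℝ (Fin d))} {R : ℝ}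

theorem sum_wassersteinDist_map_barMap_le (hp : 1 < p) (hlam : ∀ i, 0 < lam i)
    [IsProbabilityMeasure (μ 0)] (hμ : ∀ i : Fin n, μ i.succ = Measure.dirac (xhat i)) :
    ∑ i, ENNReal.ofReal (lam i) * wassersteinDist p (μ i) ((μ 0).map (barMap p lam xhat)) ^ p ≤
      ∫⁻ x, ENNReal.ofReal
        (pCost p lam (Fin.cons x xhat : Fin (n + 1) → EuclideanSpace ℝ (Fin d))
          (barMap p lam xhat x)) ∂(μ 0) := by
  have hT := (continuous_barMap (xhat := xhat) hp hlam).measurable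
  have := Measure.isProbabilityMeasure_map (μ := μ 0) hT.aemeasurable
  have hc := continuous_pCost_cons (lam := lam) (xhat := xhat) (zero_le_one.trans hp.le)
  rw [sum_wassersteinDist_rpow_eq_iInf (zero_lt_one.trans hp) hlam hμ]
  refine (iInf_le _ ⟨_, isTransportPlan_graph (μ 0) hT⟩).trans_eq ?_
  rw [lintegral_map hc.measurable.ennreal_ofReal (by fun_prop)]

theorem lintegral_pCost_barMap_le (hp : 1 < p) (hlam : ∀ i, 0 < lam i)
    (hμ : ∀ i : Fin n, μ i.succ = Measure.dirac (xhat i))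
    (ρ : Measure (EuclideanSpace ℝ (Fin d))) [IsProbabilityMeasure ρ] :
    ∫⁻ x, ENNReal.ofReal
        (pCost p lam (Fin.cons x xhat : Fin (n + 1) → EuclideanSpace ℝ (Fin d))
          (barMap p lam xhat x)) ∂(μ 0) ≤
      ∑ i, ENNReal.ofReal (lam i) * wassersteinDist p (μ i) ρ ^ p := by
  have hT := (continuous_barMap (xhat := xhat) hp hlam)
  have hc := continuous_pCost_cons (lam := lam) (xhat := xhat) (zero_le_one.trans hp.le)
  have hcT : Measurable fun x => ENNReal.ofReal
      (pCost p lam (Fin.cons x xhat : Fin (n + 1) → EuclideanSpace ℝ (Fin d))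
        (barMap p lam xhat x)) :=
    (hc.comp (continuous_id.prodMk hT)).measurable.ennreal_ofReal
  rw [sum_wassersteinDist_rpow_eq_iInf (zero_lt_one.trans hp) hlam hμ]
  refine le_iInf fun ⟨π, hπ⟩ => ?_
  dsimp only
  rw [← hπ.1, Measure.fst, lintegral_map hcT measurable_fst]
  exact lintegral_mono fun w => ENNReal.ofReal_le_ofReal (pCost_pBarycenter_le hp hlam _ _)

theorem lintegral_pCost_barMap_ne_top (hp : 1 < p) (hlam : ∀ i, 0 < lam i)
    [IsProbabilityMeasure (μ 0)] (hR : ∀ᵐ x ∂(μ 0), ‖x‖ ≤ R) :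
    ∫⁻ x, ENNReal.ofReal
        (pCost p lam (Fin.cons x xhat : Fin (n + 1) → EuclideanSpace ℝ (Fin d))
          (barMap p lam xhat x)) ∂(μ 0) ≠ ∞ := by
  have hT := (continuous_barMap (xhat := xhat) hp hlam)
  have hc := (continuous_pCost_cons (lam := lam) (xhat := xhat) (zero_le_one.trans hp.le)).comp
    (continuous_id.prodMk hT)
  obtain ⟨B, hB⟩ := (isCompact_closedBall (0 : EuclideanSpace ℝ (Fin d)) R).bddAbove_image
    hc.continuousOn
  have hle : ∀ᵐ x ∂(μ 0), ENNReal.ofReal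
      (pCost p lam (Fin.cons x xhat : Fin (n + 1) → EuclideanSpace ℝ (Fin d))
          (barMap p lam xhat x)) ≤ ENNReal.ofReal B := by
    filter_upwards [hR] with x hx
    exact ENNReal.ofReal_le_ofReal (hB ⟨x, mem_closedBall_zero_iff.2 hx, rfl⟩)
  refine ne_top_of_le_ne_top ?_ (lintegral_mono_ae hle)
  simp

theorem memProbP_map_barMap (hp : 1 < p) (hlam : ∀ i, 0 < lam i) [IsProbabilityMeasure (μ 0)]
    (hxhat : ∀ i, ‖xhat i‖ ≤ R) (hR : ∀ᵐ x ∂(μ 0), ‖x‖ ≤ R) :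
    MemProbP p ((μ 0).map (barMap p lam xhat)) := by
  have hT := (continuous_barMap (xhat := xhat) hp hlam).measurable
  refine ⟨Measure.isProbabilityMeasure_map hT.aemeasurable, ?_⟩
  rw [lintegral_map (by fun_prop) hT]
  have hle : ∀ᵐ x ∂(μ 0), ‖barMap p lam xhat x‖ₑ ^ p ≤ ENNReal.ofReal R ^ p := by
    filter_upwards [hR] with x hx
    refine ENNReal.rpow_le_rpow ?_ (by linarith)
    rw [← ofReal_norm]
    exact ENNReal.ofReal_le_ofReal (norm_barMap_le hp hlam hxhat hx)
  refine (lintegral_mono_ae hle).trans_lt ?_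
  rw [lintegral_const, measure_univ, mul_one]
  exact ENNReal.rpow_lt_top_of_nonneg (by linarith) ENNReal.ofReal_ne_top

theorem isWassersteinBarycenter_map_barMap (hp : 1 < p) (hlam : ∀ i, 0 < lam i)
    [IsProbabilityMeasure (μ 0)] (hμ : ∀ i : Fin n, μ i.succ = Measure.dirac (xhat i))
    (hxhat : ∀ i, ‖xhat i‖ ≤ R) (hR : ∀ᵐ x ∂(μ 0), ‖x‖ ≤ R) :
    IsWassersteinBarycenter p lam μ ((μ 0).map (barMap p lam xhat)) := by
  refine ⟨memProbP_map_barMap hp hlam hxhat hR, fun ρ hρ => ?_⟩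
  have := hρ.1
  exact (sum_wassersteinDist_map_barMap_le hp hlam hμ).trans
    (lintegral_pCost_barMap_le hp hlam hμ ρ)

/-- Almost optimal plans suffice: by the cost gap, excess cost below κη leaves mass at most η on
pairs (x, y) with y at distance at least r from bar_p(x). Hence ρ(F) is at most the image measure of
the r-thickening of F, plus η; let η and then r tend to 0. -/
theorem IsWassersteinBarycenter.eq_map_barMap (hp : 1 < p) (hlam : ∀ i, 0 < lam i)
    [IsProbabilityMeasure (μ 0)] (hμ : ∀ i : Fin n, μ i.succ = Measure.dirac (xhat i))
    (hxhat : ∀ i, ‖xhat i‖ ≤ R) (hR : ∀ᵐ x ∂(μ 0), ‖x‖ ≤ R)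
    {ρ : Measure (EuclideanSpace ℝ (Fin d))} (hρ : IsWassersteinBarycenter p lam μ ρ) :
    ρ = (μ 0).map (barMap p lam xhat) := by
  have hT := continuous_barMap (xhat := xhat) hp hlam
  have := hρ.1.1
  have := Measure.isProbabilityMeasure_map (μ := μ 0) hT.measurable.aemeasurable
  have hc := continuous_pCost_cons (lam := lam) (xhat := xhat) (zero_le_one.trans hp.le)
  have hcT : Measurable fun x => ENNReal.ofReal
      (pCost p lam (Fin.cons x xhat : Fin (n + 1) → EuclideanSpace ℝ (Fin d))
        (barMap p lam xhat x)) :=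
    (hc.comp (continuous_id.prodMk hT)).measurable.ennreal_ofReal
  have hfin := lintegral_pCost_barMap_ne_top (xhat := xhat) hp hlam hR
  have hle := (hρ.2 _ (memProbP_map_barMap hp hlam hxhat hR)).trans
    (sum_wassersteinDist_map_barMap_le hp hlam hμ)
  rw [sum_wassersteinDist_rpow_eq_iInf (zero_lt_one.trans hp) hlam hμ] at hle
  set I := ∫⁻ x, ENNReal.ofReal
    (pCost p lam (Fin.cons x xhat : Fin (n + 1) → EuclideanSpace ℝ (Fin d))
      (barMap p lam xhat x)) ∂(μ 0) with hI
  refine measure_eq_of_forall_isClosed_le fun F hF => ?_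
  have hthick : ∀ r : ℝ, 0 < r →
      ρ F ≤ (μ 0).map (barMap p lam xhat) (Metric.cthickening r F) := by
    intro r hr
    obtain ⟨κ, hκ, hgap⟩ := exists_pCost_gap (xhat := xhat) hp hlam hxhat hr
    refine ENNReal.le_of_forall_pos_le_add fun η hη _ => ?_
    have hκη : 0 < ENNReal.ofReal κ * η :=
      ENNReal.mul_pos (ENNReal.ofReal_pos.2 hκ).ne' (by exact_mod_cast hη.ne')
    obtain ⟨⟨π, hπ⟩, hπlt⟩ := iInf_lt_iff.1
      (hle.trans_lt (ENNReal.lt_add_right hfin hκη.ne'))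
    set bad := {w : EuclideanSpace ℝ (Fin d) × EuclideanSpace ℝ (Fin d) |
      r ≤ ‖w.2 - barMap p lam xhat w.1‖} with hbad
    have hbadm : MeasurableSet bad :=
      (isClosed_le continuous_const (by fun_prop)).measurableSet
    have hRπ : ∀ᵐ w ∂π, ‖w.1‖ ≤ R := by
      rw [← hπ.1] at hR
      exact ae_of_ae_map measurable_fst.aemeasurable hR
    -- On `bad` the cost exceeds the minimum by κ; elsewhere minimality suffices.
    have hπge : I + ENNReal.ofReal κ * π bad ≤ ∫⁻ w, ENNReal.ofReal
        (pCost p lam (Fin.cons w.1 xhat : Fin (n + 1) → EuclideanSpace ℝ (Fin d)) w.2) ∂π := by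
      rw [hI, ← hπ.1, Measure.fst, lintegral_map hcT measurable_fst,
        ← lintegral_indicator_const hbadm,
        ← lintegral_add_right _ (measurable_const.indicator hbadm)]
      refine lintegral_mono_ae ?_
      filter_upwards [hRπ] with w hw
      by_cases hwb : w ∈ bad
      · rw [Set.indicator_of_mem hwb, ← ENNReal.ofReal_add (pCost_nonneg hlam _ _) hκ.le]
        exact ENNReal.ofReal_le_ofReal (hgap _ hw _ hwb)
      · rw [Set.indicator_of_notMem hwb, add_zero]
        exact ENNReal.ofReal_le_ofReal (pCost_pBarycenter_le hp hlam _ _)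
    have hbad_le : π bad ≤ η := by
      have h1 := (ENNReal.add_lt_add_iff_left hfin).1 (hπge.trans_lt hπlt)
      exact ((ENNReal.mul_lt_mul_iff_right (ENNReal.ofReal_pos.2 hκ).ne'
        ENNReal.ofReal_ne_top).1 h1).le
    have hcover : Prod.snd ⁻¹' F ⊆
        Prod.fst ⁻¹' (barMap p lam xhat ⁻¹' Metric.cthickening r F) ∪ bad := by
      intro w hw
      by_cases hwb : w ∈ bad
      · exact Or.inr hwb
      · refine Or.inl (Metric.mem_cthickening_of_dist_le _ w.2 r F hw ?_)
        rw [dist_comm, dist_eq_norm]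
        exact (not_le.1 hwb).le
    have hcm := (Metric.isClosed_cthickening (δ := r) (E := F)).measurableSet
    calc ρ F = π (Prod.snd ⁻¹' F) := by rw [← hπ.2, Measure.snd_apply hF.measurableSet]
      _ ≤ π (Prod.fst ⁻¹' (barMap p lam xhat ⁻¹' Metric.cthickening r F)) + π bad :=
          (measure_mono hcover).trans (measure_union_le _ _)
      _ ≤ (μ 0).map (barMap p lam xhat) (Metric.cthickening r F) + η := by
          rw [Measure.map_apply hT.measurable hcm, ← hπ.1,
            Measure.fst_apply (hT.measurable hcm)]
          gcongr
  have hlim := (tendsto_measure_cthickening_of_isClosed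
    (μ := (μ 0).map (barMap p lam xhat)) ⟨1, one_pos, measure_ne_top _ _⟩ hF).mono_left
    (nhdsWithin_le_nhds (s := Set.Ioi 0))
  exact ge_of_tendsto hlim (Filter.eventually_of_mem self_mem_nhdsWithin hthick)

end Optimality

/-! ### Constants and assembly of the theorem -/

/-- The constant in the expansion bound for the inverse of `barMap`. -/
noncomputable def barMapConst (p M δ : ℝ) : ℝ :=
  1 + if 2 ≤ p then 2 * (p - 1) * (2 * (|M| / 2)) ^ (p - 2) / (δ / 2) ^ (p - 2)
    else (p - 1)⁻¹ * (2 * (|M| / 2)) ^ (2 - p) * (2 * δ ^ (p - 2))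

theorem one_le_barMapConst {p δ : ℝ} (M : ℝ) (hp : 1 < p) (hδ : 0 < δ) :
    1 ≤ barMapConst p M δ := by
  have : 0 < p - 1 := by linarith
  rw [barMapConst, le_add_iff_nonneg_right]
  split_ifs <;> positivity

section Main

variable {d n : ℕ} {p : ℝ} {lam : Fin (n + 1) → ℝ} {xhat : Fin n → EuclideanSpace ℝ (Fin d)}

theorem mem_support_dirac (a : EuclideanSpace ℝ (Fin d)) : a ∈ (Measure.dirac a).support := by
  rw [Measure.mem_support_iff_forall]
  intro U hU
  rw [Measure.dirac_apply_of_mem (mem_of_mem_nhds hU)]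
  exact one_pos

/-- The image of the compact K is closed, so a point outside it has positive distance to it; in the
second case the infimum over finitely many i is attained. -/
theorem separation_pos [NeZero n] (hp : 1 < p) (hlam : ∀ i, 0 < lam i)
    {K : Set (EuclideanSpace ℝ (Fin d))} (hK : IsCompact K) (hK' : K.Nonempty) {δ : ℝ}
    (h : (2 ≤ p ∧ zBar p lam xhat ∉ K ∧
            δ = Metric.infDist (zBar p lam xhat) (barMap p lam xhat '' K)) ∨
          (p < 2 ∧ (∀ i : Fin n, ∀ x ∈ K, barMap p lam xhat x ≠ xhat i) ∧
            δ = ⨅ i : Fin n, Metric.infDist (xhat i) (barMap p lam xhat '' K))) : 0 < δ := by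
  have hcl : IsClosed (barMap p lam xhat '' K) :=
    (hK.image (continuous_barMap hp hlam)).isClosed
  have hpos : ∀ y, y ∉ barMap p lam xhat '' K → 0 < Metric.infDist y (barMap p lam xhat '' K) :=
    fun y hy => (hcl.notMem_iff_infDist_pos (hK'.image _)).1 hy
  rcases h with ⟨_, hz, rfl⟩ | ⟨_, hne, rfl⟩
  · refine hpos _ ?_
    rintro ⟨x, hx, hxz⟩
    exact barMap_ne_zBar hp hlam (ne_of_mem_of_not_mem hx hz) hxz
  · obtain ⟨i, hi⟩ := exists_eq_ciInf_of_finite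
      (f := fun i : Fin n => Metric.infDist (xhat i) (barMap p lam xhat '' K))
    rw [← hi]
    refine hpos _ ?_
    rintro ⟨x, hx, hxi⟩
    exact hne i x hx hxi

theorem norm_sub_le_barMapConst [NeZero n] (hp : 1 < p) (hlam : ∀ i, 0 < lam i)
    (hsum : ∑ i, lam i = 1) {M : ℝ} (hxhat : ∀ i, ‖xhat i‖ ≤ |M| / 2)
    {K : Set (EuclideanSpace ℝ (Fin d))} (hKM : ∀ x ∈ K, ‖x‖ ≤ |M| / 2) {δ : ℝ} (hδ : 0 < δ)
    (h : (2 ≤ p ∧ δ = Metric.infDist (zBar p lam xhat) (barMap p lam xhat '' K)) ∨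
          (p < 2 ∧ δ = ⨅ i : Fin n, Metric.infDist (xhat i) (barMap p lam xhat '' K)))
    {x x' : EuclideanSpace ℝ (Fin d)} (hx : x ∈ K) (hx' : x' ∈ K) :
    ‖x - x'‖ ≤ barMapConst p M δ * lam 0 ^ (-(p - 1)⁻¹) *
      ‖barMap p lam xhat x - barMap p lam xhat x'‖ := by
  rcases h with ⟨h2, h⟩ | ⟨h2, h⟩
  · rw [barMapConst, if_pos h2]
    refine norm_sub_le_norm_barMap_sub_of_two_le h2 hlam hsum hxhat hδ (hKM x hx) (hKM x' hx') ?_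
    rw [← dist_eq_norm, dist_comm, h]
    exact Metric.infDist_le_dist_of_mem (Set.mem_image_of_mem _ hx)
  · rw [barMapConst, if_neg (not_le.2 h2)]
    have hδle : ∀ y ∈ K, ∀ i, δ ≤ ‖barMap p lam xhat y - xhat i‖ := by
      intro y hy i
      rw [← dist_eq_norm, dist_comm, h]
      exact (ciInf_le (Set.finite_range _).bddBelow i).trans
        (Metric.infDist_le_dist_of_mem (Set.mem_image_of_mem _ hy))
    exact norm_sub_le_norm_barMap_sub_of_le_two hp h2.le hlam hsum hxhat hδ (hKM x hx)
      (hKM x' hx') (hδle x hx) (hδle x' hx')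

theorem one_le_toReal_conjExponent {q : ℝ≥0∞} (hq : 1 < q) : 1 ≤ q.conjExponent.toReal := by
  have hfin : (q - 1)⁻¹ ≠ ∞ := ENNReal.inv_ne_top.2 (tsub_pos_of_lt hq).ne'
  rw [ENNReal.conjExponent, ENNReal.toReal_add ENNReal.one_ne_top hfin, ENNReal.toReal_one]
  exact le_add_of_nonneg_right ENNReal.toReal_nonneg

/-- Here 1 - α_p = 1/(p-1), and the factor q' ≥ 1 in the exponent only enlarges the right side
because l ≤ 1. -/
theorem expansion_pow_le {l B q' : ℝ} (d : ℕ) (hp : 1 < p) (hl : 0 < l) (hl1 : l ≤ 1) (hB : 1 ≤ B)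
    (hq : 1 ≤ q') :
    (B * l ^ (-(p - 1)⁻¹)) ^ d ≤ B ^ d / l ^ ((d : ℝ) * q' * (1 - alphaExp p)) := by
  have hpm : 0 < p - 1 := by linarith
  have hα : 1 - alphaExp p = (p - 1)⁻¹ := by
    rw [alphaExp]
    field_simp
    ring
  rw [mul_pow, div_eq_mul_inv, ← Real.rpow_neg hl.le, ← Real.rpow_natCast (l ^ _),
    ← Real.rpow_mul hl.le, hα]
  refine mul_le_mul_of_nonneg_left ?_ (by positivity)
  refine Real.rpow_le_rpow_of_exponent_ge hl hl1 ?_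
  have : 0 ≤ (p - 1)⁻¹ * d := by positivity
  nlinarith

end Main

theorem mainTheorem6 (d : ℕ) (p M : ℝ) (hp : 1 < p) :
    ∃ C : ℝ → ℝ, (∀ δ, 0 < δ → 0 < C δ) ∧
      ∀ (n : ℕ) (_ : 1 ≤ n) (lam : Fin (n + 1) → ℝ) (_ : ∀ i, 0 < lam i) (_ : ∑ i, lam i = 1)
        (μ : Fin (n + 1) → Measure (EuclideanSpace ℝ (Fin d)))
        (xhat : Fin n → EuclideanSpace ℝ (Fin d))
        (f : EuclideanSpace ℝ (Fin d) → ℝ) (q : ℝ≥0∞) (δ : ℝ),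
        IsProbabilityMeasure (μ 0) →
        (∀ i : Fin n, μ i.succ = Measure.dirac (xhat i)) →
        (∀ i, (μ i).support ⊆ Metric.ball 0 (M / 2)) →
        0 ≤ᵐ[volume] f →
        μ 0 = volume.withDensity (fun x => ENNReal.ofReal (f x)) →
        1 < q →
        MemLp f q volume →
        ((2 ≤ p ∧ zBar p lam xhat ∉ (μ 0).support ∧
            δ = Metric.infDist (zBar p lam xhat) (barMap p lam xhat '' (μ 0).support)) ∨
          (p < 2 ∧ (∀ i : Fin n, ∀ x ∈ (μ 0).support, barMap p lam xhat x ≠ xhat i) ∧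
            δ = ⨅ i : Fin n, Metric.infDist (xhat i) (barMap p lam xhat '' (μ 0).support))) →
        0 < δ ∧
        (∃! ν, IsWassersteinBarycenter p lam μ ν) ∧
        ∀ ν, IsWassersteinBarycenter p lam μ ν →
          ∃ g : EuclideanSpace ℝ (Fin d) → ℝ, 0 ≤ᵐ[volume] g ∧
            ν = volume.withDensity (fun x => ENNReal.ofReal (g x)) ∧
            MemLp g q volume ∧
            eLpNorm g q volume ≤
              ENNReal.ofReal
                (C δ / lam 0 ^ ((d : ℝ) * q.conjExponent.toReal * (1 - alphaExp p))) *
              eLpNorm f q volume := by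
  -- The d-th power turns the bound on distances into one on volumes. The constant is fixed before
  -- anything forces M > 0, which is why it is built from |M|.
  refine ⟨fun δ => barMapConst p M δ ^ d, fun δ hδ =>
    pow_pos (zero_lt_one.trans_le (one_le_barMapConst M hp hδ)) d, ?_⟩
  intro n hn lam hlam hsum μ xhat f q δ hprob hμ hsupp hf0 hμf hq hf hδdef
  have : NeZero n := ⟨by lia⟩
  set K := (μ 0).support with hKdef
  have hball : ∀ x ∈ Metric.ball (0 : EuclideanSpace ℝ (Fin d)) (M / 2), ‖x‖ ≤ |M| / 2 := by
    intro x hx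
    rw [mem_ball_zero_iff] at hx
    linarith [le_abs_self M]
  have hKM : ∀ x ∈ K, ‖x‖ ≤ |M| / 2 := fun x hx => hball x (hsupp 0 hx)
  have hxhat : ∀ i, ‖xhat i‖ ≤ |M| / 2 := fun i => by
    refine hball _ (hsupp i.succ ?_)
    rw [hμ i]
    exact mem_support_dirac _
  have hK : IsCompact K :=
    (isCompact_closedBall (0 : EuclideanSpace ℝ (Fin d)) (|M| / 2)).of_isClosed_subset
      Measure.isClosed_support fun x hx => mem_closedBall_zero_iff.2 (hKM x hx)
  have hK' : K.Nonempty := Measure.nonempty_support (IsProbabilityMeasure.ne_zero _)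
  have hδ : 0 < δ := separation_pos hp hlam hK hK' hδdef
  have hKae : ∀ᵐ x ∂(μ 0), x ∈ K := Measure.support_mem_ae
  have hR : ∀ᵐ x ∂(μ 0), ‖x‖ ≤ |M| / 2 := hKae.mono hKM
  refine ⟨hδ, ⟨_, isWassersteinBarycenter_map_barMap hp hlam hμ hxhat hR, fun ρ hρ =>
    hρ.eq_map_barMap hp hlam hμ hxhat hR⟩, fun ν hν => ?_⟩
  have hl1 : lam 0 ≤ 1 := hsum ▸
    Finset.single_le_sum (fun i _ => (hlam i).le) (Finset.mem_univ 0)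
  have hB := one_le_barMapConst M hp hδ
  set L := barMapConst p M δ * lam 0 ^ (-(p - 1)⁻¹) with hLdef
  have hL1 : 1 ≤ L := one_le_mul_of_one_le_of_one_le hB (one_le_rpow_neg_inv hp (hlam 0) hl1)
  have hL : ∀ x ∈ K, ∀ y ∈ K,
      edist x y ≤ L.toNNReal * edist (barMap p lam xhat x) (barMap p lam xhat y) := by
    intro x hx y hy
    have := norm_sub_le_barMapConst hp hlam hsum hxhat hKM hδ
      (hδdef.imp (fun h => ⟨h.1, h.2.2⟩) fun h => ⟨h.1, h.2.2⟩) hx hy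
    rw [edist_dist, edist_dist, dist_eq_norm, dist_eq_norm]
    change _ ≤ ENNReal.ofReal L * _
    rw [← ENNReal.ofReal_mul (zero_le_one.trans hL1)]
    exact ENNReal.ofReal_le_ofReal this
  obtain ⟨g, hg0, hg, hgq, hgle⟩ := exists_density_map
    (continuous_barMap (xhat := xhat) hp hlam).measurable hK (Real.one_le_toNNReal.2 hL1) hL
    hf0 hq.le hf
  -- The support carries all of `μ 0`, so restricting to K changes nothing.
  rw [← hμf, Measure.restrict_eq_self_of_ae_mem hKae] at hg
  refine ⟨g, hg0, (hν.eq_map_barMap hp hlam hμ hxhat hR).trans hg, hgq, hgle.trans ?_⟩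
  gcongr
  change ENNReal.ofReal L ^ d ≤ _
  rw [← ENNReal.ofReal_pow (zero_le_one.trans hL1)]
  exact ENNReal.ofReal_le_ofReal
    (expansion_pow_le d hp (hlam 0) hl1 hB (one_le_toReal_conjExponent hq))
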